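/- Let $B$ be a connected Hausdorff smooth orbifold of dimension $n$ (in particular $B$ may be any connected smooth manifold), and let $M\to B$ be a twisted bundle with one-dimensional abelian structure group, with an invariant Riemannian metric $\overline g$. Explicitly: $B$ is covered by uniformizing charts $U_a\to B$, with $U_a\subset\mathbb R^n$ open and connected; the total space has adapted coordinates $(x,b)\in\mathbb R\times U_a$, with $x$ a linear coordinate on the fibers, in which $$\overline g = G\,(dx+A)^2+\sum_{\alpha,\beta}g_{\alpha\beta}\,db^\alpha db^\beta ,$$ where $G>0$ is a smooth function on $B$, $g=(g_{\alpha\beta})$ is a Riemannian metric on $B$ and $A=\sum_\alpha A_\alpha\,db^\alpha$ is a smooth $1$-form on $U_a$. The coordinate changes are, locally, of the form $(x,b)\mapsto(\gamma\,(x-f(b)),h(b))$, where $h$ is a change of charts of $B$, $f$ is smooth, and $\gamma\in\{1,-1\}$ is locally constant and is a cocycle (the flat line bundle of Lie algebras of the fibers has holonomy in $\{\pm1\}$). The coordinate changes are isometries, i.e. $h^*g=g$ and $h^*A=\gamma\,(A+df)$. Let $F=dA$, that is, $F_{\alpha\beta}=\partial_\alpha A_\beta-\partial_\beta A_\alpha$.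 The connected Riemannian orbifold $(B,g)$ is called parabolic if every nonnegative $C^2$ function $u$ on $B$ that is bounded above and satisfies $\triangle u\ge0$ is constant. Suppose that $\operatorname{Ric}(\overline g)=\lambda\,\overline g$ for some $\lambda\in\mathbb R$ with $\lambda\le 0$, that $(B,g)$ is parabolic, and that $G$ is bounded above. Then $G$ is constant, $F=0$, $\lambda=0$ and $(B,g)$ is Ricci-flat. If moreover $n=3$ (so that $\overline g$ is a four-dimensional metric), then $(B,g)$ is flat. -/

import Mathlib

open scoped ContDiff

/-! ### Riemannian geometry in coordinates

A metric on an open subset of `ℝ^ι` is given by its matrix of components `g x i j`. -/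

namespace Coord

variable {ι : Type*} [Fintype ι] [DecidableEq ι]

/-- The partial derivative `∂f/∂xⁱ`. -/
noncomputable def pd (i : ι) (f : (ι → ℝ) → ℝ) (x : ι → ℝ) : ℝ :=
  fderiv ℝ f x (Pi.single i 1)

/-- The Christoffel symbol `Γᵏᵢⱼ = ½ gᵏˡ (∂ᵢ gⱼₗ + ∂ⱼ gᵢₗ - ∂ₗ gᵢⱼ)`. -/
noncomputable def christoffel (g : (ι → ℝ) → Matrix ι ι ℝ) (k i j : ι) (x : ι → ℝ) : ℝ :=
  (1 / 2) * ∑ l, (g x)⁻¹ k l *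
    (pd i (fun y => g y j l) x + pd j (fun y => g y i l) x - pd l (fun y => g y i j) x)

/-- The curvature tensor: `riemann g l k i j` is the `∂ₗ`-component of `R(∂ᵢ, ∂ⱼ) ∂ₖ`, where
`R(X, Y) = [∇_X, ∇_Y] - ∇_[X, Y]`. -/
noncomputable def riemann (g : (ι → ℝ) → Matrix ι ι ℝ) (l k i j : ι) (x : ι → ℝ) : ℝ :=
  pd i (christoffel g l j k) x - pd j (christoffel g l i k) x +
    ∑ m, (christoffel g l i m x * christoffel g m j k x -
      christoffel g l j m x * christoffel g m i k x)

/-- The Ricci tensor `Ric(Y, Z) = tr (X ↦ R(X, Y) Z)` (positive on round spheres). -/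
noncomputable def ricci (g : (ι → ℝ) → Matrix ι ι ℝ) (j k : ι) (x : ι → ℝ) : ℝ :=
  ∑ i, riemann g i k i j x

/-- The Laplace-Beltrami operator `△f = gⁱʲ (∂ᵢ∂ⱼ f - Γᵏᵢⱼ ∂ₖ f)`, the trace of the Hessian. -/
noncomputable def laplacian (g : (ι → ℝ) → Matrix ι ι ℝ) (f : (ι → ℝ) → ℝ) (x : ι → ℝ) : ℝ :=
  ∑ i, ∑ j, (g x)⁻¹ i j * (pd i (pd j f) x - ∑ k, christoffel g k i j x * pd k f x)

/-- The matrix of components `g` is a smooth Riemannian metric on the set `U`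
(`Matrix.PosDef` includes symmetry). -/
def IsMetricOn (g : (ι → ℝ) → Matrix ι ι ℝ) (U : Set (ι → ℝ)) : Prop :=
  (∀ i j, ContDiffOn ℝ ∞ (fun x => g x i j) U) ∧ ∀ x ∈ U, (g x).PosDef

end Coord

/-! ### Orbifolds -/

/-- A smooth `n`-dimensional orbifold structure on a topological space `B`: a family of
uniformizing charts `q a : U a → B`, with `U a` a connected open subset of `ℝⁿ`, each inducing a
homeomorphism from the quotient of `U a` by a finite group `Γ a` of diffeomorphisms of `U a` onto
an open subset of `B`; these open subsets cover `B`, and two points of charts over the same point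
of `B` are related by a local diffeomorphism over `B`.  Smooth manifolds are the case where all
the groups are trivial. -/
structure OrbifoldAtlas.{u, v} (n : ℕ) (B : Type v) [TopologicalSpace B] where
  /-- the indices of the charts -/
  ι : Type u
  /-- the domains of the charts -/
  U : ι → Set (Fin n → ℝ)
  /-- the charts; only the values on `U a` matter -/
  q : ι → (Fin n → ℝ) → B
  /-- the local groups -/
  Γ : ι → Type
  [group : ∀ a, Group (Γ a)]
  [finite : ∀ a, Finite (Γ a)]
  /-- the action of `Γ a` on `U a` -/
  act : ∀ a, Γ a → (Fin n → ℝ) → (Fin n → ℝ)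
  isOpen_U : ∀ a, IsOpen (U a)
  isConnected_U : ∀ a, IsConnected (U a)
  act_mem : ∀ a k, ∀ x ∈ U a, act a k x ∈ U a
  act_smooth : ∀ a k, ContDiffOn ℝ ∞ (act a k) (U a)
  act_one : ∀ a, ∀ x ∈ U a, act a 1 x = x
  act_mul : ∀ a k l, ∀ x ∈ U a, act a (k * l) x = act a k (act a l x)
  act_effective : ∀ a k, (∀ x ∈ U a, act a k x = x) → k = 1
  q_continuous : ∀ a, ContinuousOn (q a) (U a)
  q_open : ∀ a, ∀ W ⊆ U a, IsOpen W → IsOpen (q a '' W)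
  q_eq_iff : ∀ a, ∀ x ∈ U a, ∀ y ∈ U a, q a x = q a y ↔ ∃ k, act a k x = y
  cover : ∀ b, ∃ a, ∃ x ∈ U a, q a x = b
  compatible : ∀ a b, ∀ x ∈ U a, ∀ y ∈ U b, q a x = q b y →
    ∃ h : OpenPartialHomeomorph (Fin n → ℝ) (Fin n → ℝ),
      h.source ⊆ U a ∧ h.target ⊆ U b ∧
      ContDiffOn ℝ ∞ h h.source ∧ ContDiffOn ℝ ∞ h.symm h.target ∧
      (∀ z ∈ h.source, q b (h z) = q a z) ∧ x ∈ h.source ∧ h x = y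

namespace OrbifoldAtlas

variable {n : ℕ} {B : Type*} [TopologicalSpace B]

/-- The changes of charts from `a` to `b`: the diffeomorphisms from an open subset of `U a` onto
an open subset of `U b` that lie over the identity of `B`. -/
def IsChange (O : OrbifoldAtlas n B) (a b : O.ι)
    (h : OpenPartialHomeomorph (Fin n → ℝ) (Fin n → ℝ)) : Prop :=
  h.source ⊆ O.U a ∧ h.target ⊆ O.U b ∧
  ContDiffOn ℝ ∞ h h.source ∧ ContDiffOn ℝ ∞ h.symm h.target ∧
  ∀ z ∈ h.source, O.q b (h z) = O.q a z

/-- A Riemannian metric on an orbifold: a metric on each chart domain, for which the changes of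
charts (so also the elements of the local groups) are isometries. -/
structure Metric (O : OrbifoldAtlas n B) where
  g : O.ι → (Fin n → ℝ) → Matrix (Fin n) (Fin n) ℝ
  isMetric : ∀ a, Coord.IsMetricOn (g a) (O.U a)
  isometry : ∀ a b h, O.IsChange a b h → ∀ x ∈ h.source, ∀ i j,
    g a x i j = ∑ k, ∑ l,
      Coord.pd i (fun y => h y k) x * Coord.pd j (fun y => h y l) x * g b (h x) k l

namespace Metric

variable {O : OrbifoldAtlas n B} (gB : O.Metric)

/-- Parabolicity (of a connected Riemannian orbifold): every nonnegative function of class `C²`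
that is bounded above and satisfies `△f ≥ 0` is constant. -/
def IsParabolic : Prop :=
  ∀ f : B → ℝ, (∀ b, 0 ≤ f b) → (∃ C, ∀ b, f b ≤ C) →
    (∀ a, ContDiffOn ℝ 2 (f ∘ O.q a) (O.U a)) →
    (∀ a, ∀ x ∈ O.U a, 0 ≤ Coord.laplacian (gB.g a) (f ∘ O.q a) x) →
    ∃ c, ∀ b, f b = c

def IsRicciFlat : Prop :=
  ∀ a, ∀ x ∈ O.U a, ∀ i j, Coord.ricci (gB.g a) i j x = 0

def IsFlat : Prop :=
  ∀ a, ∀ x ∈ O.U a, ∀ l k i j, Coord.riemann (gB.g a) l k i j x = 0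

end Metric

/-- A twisted bundle over the orbifold, with one-dimensional abelian structure group, together
with an invariant Riemannian metric on its total space.  Over the chart `U a`
the total space has adapted coordinates `(x, b) ∈ ℝ × U a`, with `x` a linear coordinate on the
fibers, in which the metric is `G (dx + A)² + g`.  The coordinate changes are
`(x, b) ↦ (γ (x - f b), h b)` with `h` a change of charts of the base, `f` smooth (determined up
to a locally constant function) and `γ` locally constant.  The functions `γ` are a cocycle, that
of the flat line bundle of the Lie algebras of the fibers; its holonomy is in `{1, -1}` and the
fiber coordinates are adapted to this, so that `G` is a function on the base. -/
structure InvariantMetric (O : OrbifoldAtlas n B) where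
  /-- the metric on the base -/
  base : O.Metric
  /-- the squared length of the infinitesimal generator `∂/∂x` of the local action -/
  G : B → ℝ
  /-- the connection form on each chart -/
  A : O.ι → (Fin n → ℝ) → Fin n → ℝ
  /-- the sign by which a change of charts acts on the Lie algebra of the fibers -/
  γ : O.ι → O.ι → OpenPartialHomeomorph (Fin n → ℝ) (Fin n → ℝ) → (Fin n → ℝ) → ℤˣ
  G_pos : ∀ b, 0 < G b
  G_smooth : ∀ a, ContDiffOn ℝ ∞ (G ∘ O.q a) (O.U a)
  A_smooth : ∀ a i, ContDiffOn ℝ ∞ (fun x => A a x i) (O.U a)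
  γ_locallyConst : ∀ a b h, O.IsChange a b h → ∀ x ∈ h.source,
    ∀ᶠ y in nhds x, γ a b h y = γ a b h x
  γ_cocycle : ∀ a b c h k l, O.IsChange a b h → O.IsChange b c k → O.IsChange a c l →
    ∀ x ∈ h.source, h x ∈ k.source → x ∈ l.source → (∀ᶠ y in nhds x, k (h y) = l y) →
    γ a c l x = γ b c k (h x) * γ a b h x
  A_change : ∀ a b h, O.IsChange a b h → ∀ x ∈ h.source,
    ∃ W : Set (Fin n → ℝ), ∃ f : (Fin n → ℝ) → ℝ, IsOpen W ∧ x ∈ W ∧ W ⊆ h.source ∧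
      ContDiffOn ℝ ∞ f W ∧ ∀ y ∈ W, ∀ i,
        ∑ k, Coord.pd i (fun z => h z k) y * A b (h y) k =
          ((γ a b h y : ℤ) : ℝ) * (A a y i + Coord.pd i f y)

namespace InvariantMetric

variable {O : OrbifoldAtlas n B} (X : O.InvariantMetric)

/-- The curvature form `F = dA` of the connection, on each chart. -/
noncomputable def F (a : O.ι) (i j : Fin n) (x : Fin n → ℝ) : ℝ :=
  Coord.pd i (fun y => X.A a y j) x - Coord.pd j (fun y => X.A a y i) x

/-- The metric `G (dx + A)² + g` of the total space, in the coordinates `p = (x, b)` over the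
chart `U a`: `Sum.inl ()` is the index of `x`, and `Sum.inr i` is the index of `bⁱ`. -/
noncomputable def totalMetric (a : O.ι) (p : Unit ⊕ Fin n → ℝ) :
    Matrix (Unit ⊕ Fin n) (Unit ⊕ Fin n) ℝ :=
  X.G (O.q a (p ∘ Sum.inr)) •
      Matrix.vecMulVec (Sum.elim (fun _ => 1) (X.A a (p ∘ Sum.inr)))
        (Sum.elim (fun _ => 1) (X.A a (p ∘ Sum.inr))) +
    Matrix.fromBlocks 0 0 0 (X.base.g a (p ∘ Sum.inr))

/-- The total space is Einstein: its Ricci tensor is `lam` times its metric. -/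
def IsEinstein (lam : ℝ) : Prop :=
  ∀ a, ∀ p : Unit ⊕ Fin n → ℝ, p ∘ Sum.inr ∈ O.U a → ∀ i j,
    Coord.ricci (X.totalMetric a) i j p = lam * X.totalMetric a p i j

end InvariantMetric

end OrbifoldAtlas

/-! Everything rests on the fiber component of the Einstein equation. For a metric `φ (dx + A)² + g`
whose coefficients do not depend on `x`, `ricci_inl_inl` computes Ric(∂ₓ, ∂ₓ) = -½ △φ + ¼ |dφ|²/φ +
¼ φ² |F|², with |F|² = Fᵢⱼ Fⁱʲ. Setting this equal to λG gives ½ △G = ¼ |dG|²/G + ¼ G² |F|² - λG,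
and for λ ≤ 0 every term on the right is nonnegative. So G is a bounded positive subharmonic
function, and parabolicity makes it constant. The left side then vanishes, hence so does each term
on the right: F = 0 and λ = 0.

Once φ is constant and F = 0, the field ∂ₓ is parallel (`christoffel_inl_left`), the total space is
locally a Riemannian product, and its horizontal Ricci curvature is that of the base
(`ricci_inr_inr`). Thus the base is Ricci-flat. In dimension three the Ricci contraction is
injective on tensors antisymmetric in each index pair (`eq_zero_of_contraction`), so the base is
flat.

Only parabolicity is global; the rest is a computation in a single chart. The form A is never gauged
away, so terms containing A undifferentiated must cancel in the sums. -/

namespace Coord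

set_option linter.unusedSectionVars false

variable {ι : Type*} [Fintype ι] [DecidableEq ι]

/-! ### Calculus of partial derivatives -/

section Calculus

variable {f h : (ι → ℝ) → ℝ} {x : ι → ℝ} {U : Set (ι → ℝ)}

theorem pd_add (i : ι) (hf : DifferentiableAt ℝ f x) (hh : DifferentiableAt ℝ h x) :
    pd i (fun y => f y + h y) x = pd i f x + pd i h x := by
  simp [pd, fderiv_fun_add hf hh]

theorem pd_mul (i : ι) (hf : DifferentiableAt ℝ f x) (hh : DifferentiableAt ℝ h x) :
    pd i (fun y => f y * h y) x = pd i f x * h x + f x * pd i h x := by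
  simp [pd, fderiv_fun_mul hf hh]; ring

theorem pd_const (i : ι) (c : ℝ) (x : ι → ℝ) : pd i (fun _ => c) x = 0 := by
  simp [pd]

theorem pd_const_mul (i : ι) (c : ℝ) (hf : DifferentiableAt ℝ f x) :
    pd i (fun y => c * f y) x = c * pd i f x := by
  rw [pd_mul i (differentiableAt_const c) hf, pd_const]; ring

theorem pd_sum {κ : Type*} (s : Finset κ) (i : ι) {u : κ → (ι → ℝ) → ℝ}
    (hu : ∀ k ∈ s, DifferentiableAt ℝ (u k) x) :
    pd i (fun y => ∑ k ∈ s, u k y) x = ∑ k ∈ s, pd i (u k) x := by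
  simp [pd, fderiv_fun_sum hu]

theorem pd_sum_mul {κ : Type*} (s : Finset κ) (i : ι) {u v : κ → (ι → ℝ) → ℝ}
    (hu : ∀ k, DifferentiableAt ℝ (u k) x) (hv : ∀ k, DifferentiableAt ℝ (v k) x) :
    pd i (fun y => ∑ k ∈ s, u k y * v k y) x =
      ∑ k ∈ s, (pd i (u k) x * v k x + u k x * pd i (v k) x) := by
  rw [pd_sum s i fun k _ => (hu k).fun_mul (hv k)]
  exact Finset.sum_congr rfl fun k _ => pd_mul i (hu k) (hv k)

theorem pd_congr (i : ι) (hU : IsOpen U) (hx : x ∈ U) (hfh : ∀ y ∈ U, f y = h y) :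
    pd i f x = pd i h x := by
  have : f =ᶠ[nhds x] h := by
    filter_upwards [hU.mem_nhds hx] with y hy using hfh y hy
  simp [pd, this.fderiv_eq]

theorem differentiableAt_of_contDiffOn (hU : IsOpen U) (hf : ContDiffOn ℝ ∞ f U) (hx : x ∈ U) :
    DifferentiableAt ℝ f x :=
  (hf.contDiffAt (hU.mem_nhds hx)).differentiableAt (by simp)

theorem contDiffOn_pd (hU : IsOpen U) (hf : ContDiffOn ℝ ∞ f U) (i : ι) :
    ContDiffOn ℝ ∞ (pd i f) U := by
  have := hf.fderiv_of_isOpen hU (m := ∞) (by simp)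
  exact this.clm_apply contDiffOn_const

theorem pd_comm (hU : IsOpen U) (hf : ContDiffOn ℝ ∞ f U) (hx : x ∈ U) (i j : ι) :
    pd i (pd j f) x = pd j (pd i f) x := by
  have hfx := hf.contDiffAt (hU.mem_nhds hx)
  have hd : DifferentiableAt ℝ (fderiv ℝ f) x :=
    (hfx.fderiv_right (m := 1) (WithTop.coe_le_coe.2 le_top)).differentiableAt (by simp)
  have key : ∀ k l : ι, pd k (pd l f) x
      = fderiv ℝ (fderiv ℝ f) x (Pi.single k 1) (Pi.single l 1) := by
    intro k l
    unfold pd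
    rw [fderiv_clm_apply hd (differentiableAt_const _)]
    simp
  rw [key, key]
  exact (hfx.isSymmSndFDerivAt (by simpa using WithTop.coe_le_coe.2 (le_top (a := (2 : ℕ∞))))) _ _

end Calculus

section Inverse

variable {g : (ι → ℝ) → Matrix ι ι ℝ} {U : Set (ι → ℝ)} {x : ι → ℝ}

theorem contDiffOn_det (hg : ∀ i j, ContDiffOn ℝ ∞ (fun x => g x i j) U) :
    ContDiffOn ℝ ∞ (fun x => (g x).det) U := by
  simp only [Matrix.det_apply]
  exact ContDiffOn.sum fun σ _ => ContDiffOn.const_smul _ (contDiffOn_prod fun i _ => hg _ _)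

theorem contDiffOn_inv (hg : ∀ i j, ContDiffOn ℝ ∞ (fun x => g x i j) U)
    (hdet : ∀ x ∈ U, (g x).det ≠ 0) (i j : ι) :
    ContDiffOn ℝ ∞ (fun x => (g x)⁻¹ i j) U := by
  have h2 : ContDiffOn ℝ ∞ (fun x => (g x).adjugate i j) U := by
    simp only [Matrix.adjugate_apply]
    -- An adjugate entry is itself a determinant, that of `g` with one row made constant.
    refine contDiffOn_det (g := fun x => (g x).updateRow j (Pi.single i 1)) fun k l => ?_
    by_cases hk : k = j
    · subst hk; simpa using contDiffOn_const
    · simpa [Matrix.updateRow_ne hk] using hg k l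
  have := ((contDiffOn_det hg).inv hdet).mul h2
  refine this.congr fun x _ => ?_
  simp [Matrix.inv_def]

end Inverse

/-! ### Inverse metric, Levi-Civita connection and Laplacian -/

namespace IsMetricOn

variable {g : (ι → ℝ) → Matrix ι ι ℝ} {U : Set (ι → ℝ)} {x : ι → ℝ}

theorem symm (hg : IsMetricOn g U) (hx : x ∈ U) (i j : ι) : g x i j = g x j i := by
  simpa using (hg.2 x hx).isHermitian.apply j i

theorem inv_symm (hg : IsMetricOn g U) (hx : x ∈ U) (i j : ι) : (g x)⁻¹ i j = (g x)⁻¹ j i := by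
  simpa using (hg.2 x hx).inv.isHermitian.apply j i

theorem det_ne_zero (hg : IsMetricOn g U) (hx : x ∈ U) : (g x).det ≠ 0 :=
  (hg.2 x hx).det_pos.ne'

theorem sum_mul_inv (hg : IsMetricOn g U) (hx : x ∈ U) (i j : ι) :
    ∑ k, g x i k * (g x)⁻¹ k j = if i = j then 1 else 0 := by
  have := Matrix.mul_nonsing_inv (g x) (isUnit_iff_ne_zero.2 (hg.det_ne_zero hx))
  rw [← Matrix.mul_apply, this, Matrix.one_apply]

theorem sum_inv_mul (hg : IsMetricOn g U) (hx : x ∈ U) (i j : ι) :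
    ∑ k, (g x)⁻¹ i k * g x k j = if i = j then 1 else 0 := by
  have := Matrix.nonsing_inv_mul (g x) (isUnit_iff_ne_zero.2 (hg.det_ne_zero hx))
  rw [← Matrix.mul_apply, this, Matrix.one_apply]

theorem contDiffOn_inv (hg : IsMetricOn g U) (i j : ι) :
    ContDiffOn ℝ ∞ (fun x => (g x)⁻¹ i j) U :=
  Coord.contDiffOn_inv hg.1 (fun _ hx => hg.det_ne_zero hx) i j

theorem pd_symm (hg : IsMetricOn g U) (hU : IsOpen U) (hx : x ∈ U) (k i j : ι) :
    pd k (fun y => g y i j) x = pd k (fun y => g y j i) x :=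
  pd_congr k hU hx fun _ hy => hg.symm hy i j

end IsMetricOn

/-- The Christoffel symbol of the first kind `½ (∂ᵢ gⱼₗ + ∂ⱼ gᵢₗ - ∂ₗ gᵢⱼ)`. -/
noncomputable def christoffelLower (g : (ι → ℝ) → Matrix ι ι ℝ) (l i j : ι) (x : ι → ℝ) : ℝ :=
  (1 / 2) *
    (pd i (fun y => g y j l) x + pd j (fun y => g y i l) x - pd l (fun y => g y i j) x)

theorem christoffel_eq_sum (g : (ι → ℝ) → Matrix ι ι ℝ) (k i j : ι) (x : ι → ℝ) :
    christoffel g k i j x = ∑ l, (g x)⁻¹ k l * christoffelLower g l i j x := by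
  simp only [christoffel, christoffelLower, Finset.mul_sum]
  exact Finset.sum_congr rfl fun l _ => by ring

namespace IsMetricOn

variable {g : (ι → ℝ) → Matrix ι ι ℝ} {U : Set (ι → ℝ)} {x : ι → ℝ}

theorem christoffelLower_symm (hg : IsMetricOn g U) (hU : IsOpen U) (hx : x ∈ U) (l i j : ι) :
    christoffelLower g l i j x = christoffelLower g l j i x := by
  simp only [christoffelLower, hg.pd_symm hU hx l i j]; ring

theorem christoffel_symm (hg : IsMetricOn g U) (hU : IsOpen U) (hx : x ∈ U) (l i j : ι) :
    christoffel g l i j x = christoffel g l j i x := by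
  simp only [christoffel_eq_sum, hg.christoffelLower_symm hU hx _ i j]

/-- The Levi-Civita connection is metric. -/
theorem pd_eq_christoffelLower (hg : IsMetricOn g U) (hU : IsOpen U) (hx : x ∈ U) (i j k : ι) :
    pd i (fun y => g y j k) x = christoffelLower g k i j x + christoffelLower g j i k x := by
  simp only [christoffelLower]
  rw [hg.pd_symm hU hx i k j]
  ring

theorem contDiffOn_christoffelLower (hg : IsMetricOn g U) (hU : IsOpen U) (l i j : ι) :
    ContDiffOn ℝ ∞ (christoffelLower g l i j) U := by
  unfold christoffelLower
  exact contDiffOn_const.mul (((contDiffOn_pd hU (hg.1 _ _) _).add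
    (contDiffOn_pd hU (hg.1 _ _) _)).sub (contDiffOn_pd hU (hg.1 _ _) _))

theorem contDiffOn_christoffel (hg : IsMetricOn g U) (hU : IsOpen U) (l i j : ι) :
    ContDiffOn ℝ ∞ (christoffel g l i j) U := by
  have : christoffel g l i j = fun x => ∑ m, (g x)⁻¹ l m * christoffelLower g m i j x :=
    funext fun x => christoffel_eq_sum g l i j x
  rw [this]
  exact ContDiffOn.sum fun m _ => (hg.contDiffOn_inv l m).mul
    (hg.contDiffOn_christoffelLower hU m i j)

theorem sum_mul_christoffel (hg : IsMetricOn g U) (hx : x ∈ U) (l i j : ι) :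
    ∑ k, g x l k * christoffel g k i j x = christoffelLower g l i j x := by
  simp only [christoffel_eq_sum, Finset.mul_sum]
  rw [Finset.sum_comm]
  simp only [← mul_assoc, ← Finset.sum_mul, hg.sum_mul_inv hx]
  simp

/-- Differentiate g g⁻¹ = 1 and multiply by g⁻¹ on the left. -/
theorem pd_inv (hg : IsMetricOn g U) (hU : IsOpen U) (hx : x ∈ U) (k i j : ι) :
    pd k (fun y => (g y)⁻¹ i j) x =
      -∑ a, ∑ b, (g x)⁻¹ i a * pd k (fun y => g y a b) x * (g x)⁻¹ b j := by
  have hd : ∀ a b, DifferentiableAt ℝ (fun y => g y a b) x := fun a b =>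
    differentiableAt_of_contDiffOn hU (hg.1 a b) hx
  have hdi : ∀ a b, DifferentiableAt ℝ (fun y => (g y)⁻¹ a b) x := fun a b =>
    differentiableAt_of_contDiffOn hU (hg.contDiffOn_inv a b) hx
  have key : ∀ a, ∑ b, g x a b * pd k (fun y => (g y)⁻¹ b j) x
      = -∑ b, pd k (fun y => g y a b) x * (g x)⁻¹ b j := by
    intro a
    have h0 : pd k (fun y => ∑ b, g y a b * (g y)⁻¹ b j) x = 0 := by
      rw [pd_congr k hU hx (fun y hy => hg.sum_mul_inv hy a j), pd_const]
    rw [pd_sum_mul _ _ (hd a) (hdi · j), Finset.sum_add_distrib] at h0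
    linarith
  have h1 : ∑ a, (g x)⁻¹ i a * ∑ b, g x a b * pd k (fun y => (g y)⁻¹ b j) x
      = pd k (fun y => (g y)⁻¹ i j) x := by
    simp only [Finset.mul_sum]
    rw [Finset.sum_comm]
    simp only [← mul_assoc, ← Finset.sum_mul, hg.sum_inv_mul hx]
    simp
  rw [← h1]
  simp only [key, mul_neg, Finset.sum_neg_distrib, Finset.mul_sum, mul_assoc]

/-- The divergence of the inverse metric. -/
theorem sum_pd_inv (hg : IsMetricOn g U) (hU : IsOpen U) (hx : x ∈ U) (l : ι) :
    ∑ k, pd k (fun y => (g y)⁻¹ k l) x =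
      -∑ m, (∑ k, christoffel g k k m x) * (g x)⁻¹ m l
      - ∑ i, ∑ j, (g x)⁻¹ i j * christoffel g l i j x := by
  have e1 : ∑ m, (∑ k, christoffel g k k m x) * (g x)⁻¹ m l
      = ∑ k, ∑ a, ∑ b, (g x)⁻¹ k a * christoffelLower g a k b x * (g x)⁻¹ b l := by
    simp only [christoffel_eq_sum, Finset.sum_mul]
    rw [Finset.sum_comm]
    exact Finset.sum_congr rfl fun k _ => Finset.sum_comm
  have e2 : ∑ i, ∑ j, (g x)⁻¹ i j * christoffel g l i j x
      = ∑ k, ∑ a, ∑ b, (g x)⁻¹ k a * christoffelLower g b k a x * (g x)⁻¹ b l := by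
    simp only [christoffel_eq_sum, Finset.mul_sum]
    refine Finset.sum_congr rfl fun k _ => Finset.sum_congr rfl fun a _ =>
      Finset.sum_congr rfl fun b _ => ?_
    rw [hg.inv_symm hx l b]; ring
  -- Metric compatibility splits ∂g into two Christoffel symbols of the first kind; `e1` and `e2`
  -- identify the two resulting sums.
  simp only [hg.pd_inv hU hx, hg.pd_eq_christoffelLower hU hx, e1, e2, Finset.sum_neg_distrib]
  simp only [mul_add, add_mul, Finset.sum_add_distrib]
  ring

/-- The Laplacian in divergence form. -/
theorem laplacian_eq (hg : IsMetricOn g U) (hU : IsOpen U) (hx : x ∈ U) {f : (ι → ℝ) → ℝ}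
    (hf : ContDiffOn ℝ ∞ f U) :
    laplacian g f x = ∑ k, pd k (fun y => ∑ l, (g y)⁻¹ k l * pd l f y) x +
      ∑ m, (∑ k, christoffel g k k m x) * ∑ l, (g x)⁻¹ m l * pd l f x := by
  have hdi : ∀ a b, DifferentiableAt ℝ (fun y => (g y)⁻¹ a b) x := fun a b =>
    differentiableAt_of_contDiffOn hU (hg.contDiffOn_inv a b) hx
  have hdf : ∀ l, DifferentiableAt ℝ (fun y => pd l f y) x := fun l =>
    differentiableAt_of_contDiffOn hU (contDiffOn_pd hU hf l) hx
  have h1 : ∑ k, pd k (fun y => ∑ l, (g y)⁻¹ k l * pd l f y) x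
      = ∑ l, (∑ k, pd k (fun y => (g y)⁻¹ k l) x) * pd l f x
        + ∑ k, ∑ l, (g x)⁻¹ k l * pd k (pd l f) x := by
    simp only [Finset.sum_mul]
    rw [Finset.sum_comm, ← Finset.sum_add_distrib]
    refine Finset.sum_congr rfl fun k _ => ?_
    rw [pd_sum_mul _ _ (hdi k) hdf, ← Finset.sum_add_distrib]
  rw [h1]
  simp only [hg.sum_pd_inv hU hx, sub_mul, neg_mul, Finset.sum_sub_distrib,
    Finset.sum_neg_distrib]
  have h2 : ∑ l, (∑ m, (∑ k, christoffel g k k m x) * (g x)⁻¹ m l) * pd l f x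
      = ∑ m, (∑ k, christoffel g k k m x) * ∑ l, (g x)⁻¹ m l * pd l f x := by
    simp only [Finset.sum_mul _ _ (pd _ f x), Finset.mul_sum _ _ (∑ k, christoffel g k k _ x)]
    rw [Finset.sum_comm]
    simp only [mul_assoc]
  have h3 : ∑ l, (∑ i, ∑ j, (g x)⁻¹ i j * christoffel g l i j x) * pd l f x
      = ∑ i, ∑ j, (g x)⁻¹ i j * ∑ k, christoffel g k i j x * pd k f x := by
    simp only [Finset.sum_mul, Finset.mul_sum]
    rw [Finset.sum_comm]
    refine Finset.sum_congr rfl fun i _ => ?_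
    rw [Finset.sum_comm]
    simp only [mul_assoc]
  rw [h2, h3]
  simp only [laplacian, mul_sub, Finset.sum_sub_distrib]
  ring

/-- The trace of the Christoffel symbols. -/
theorem sum_christoffel (hg : IsMetricOn g U) (hU : IsOpen U) (hx : x ∈ U) (m : ι) :
    ∑ k, christoffel g k k m x =
      (1 / 2) * ∑ k, ∑ l, (g x)⁻¹ k l * pd m (fun y => g y k l) x := by
  -- Of the three derivatives in the Christoffel symbol, two cancel in the trace because g⁻¹ is
  -- symmetric.
  have h1 : ∑ k, ∑ l, (g x)⁻¹ k l * pd k (fun y => g y m l) x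
      = ∑ k, ∑ l, (g x)⁻¹ k l * pd l (fun y => g y k m) x := by
    rw [Finset.sum_comm]
    refine Finset.sum_congr rfl fun k _ => Finset.sum_congr rfl fun l _ => ?_
    rw [hg.inv_symm hx, hg.pd_symm hU hx]
  simp only [christoffel_eq_sum, christoffelLower, mul_left_comm _ (1 / 2 : ℝ), ← Finset.mul_sum,
    mul_sub, mul_add, Finset.sum_sub_distrib, Finset.sum_add_distrib, h1]
  ring

end IsMetricOn

/-! ### Functions and metrics invariant along the fibers -/

section Pullback

variable {φ : (ι → ℝ) → ℝ} {p : Unit ⊕ ι → ℝ}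

theorem contDiff_comp_inr : ContDiff ℝ ∞ (fun p : Unit ⊕ ι → ℝ => p ∘ Sum.inr) :=
  contDiff_pi.2 fun i => contDiff_apply ℝ ℝ (Sum.inr i)

/-- This needs no differentiability: restricting the pullback to a slice x = const recovers φ, so φ
and its pullback are differentiable together, and otherwise both derivatives take the default value
0. -/
theorem pd_inr_comp_inr (φ : (ι → ℝ) → ℝ) (p : Unit ⊕ ι → ℝ) (i : ι) :
    pd (Sum.inr i) (fun p => φ (p ∘ Sum.inr)) p = pd i φ (p ∘ Sum.inr) := by
  let π : (Unit ⊕ ι → ℝ) →L[ℝ] (ι → ℝ) :=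
    ContinuousLinearMap.pi fun i => ContinuousLinearMap.proj (Sum.inr i)
  by_cases hφ : DifferentiableAt ℝ φ (p ∘ Sum.inr)
  · have h : HasFDerivAt (fun p => φ (p ∘ Sum.inr)) ((fderiv ℝ φ (p ∘ Sum.inr)).comp π) p :=
      HasFDerivAt.comp p (f := π) hφ.hasFDerivAt π.hasFDerivAt
    have : π (Pi.single (Sum.inr i) 1) = Pi.single i 1 := by
      ext j; simp [π, Pi.single_apply]
    simp [pd, h.fderiv, this]
  · have hn : ¬ DifferentiableAt ℝ (fun p : Unit ⊕ ι → ℝ => φ (p ∘ Sum.inr)) p := by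
      intro h
      apply hφ
      have hs : DifferentiableAt ℝ
          (fun y : ι → ℝ => (Sum.elim (p ∘ Sum.inl) y : Unit ⊕ ι → ℝ)) (p ∘ Sum.inr) := by
        rw [differentiableAt_pi]
        rintro (j | j)
        · simp
        · simpa using differentiableAt_apply j _
      have h' : DifferentiableAt ℝ (fun p : Unit ⊕ ι → ℝ => φ (p ∘ Sum.inr))
          (Sum.elim (p ∘ Sum.inl) (p ∘ Sum.inr)) := by simpa using h
      simpa [Function.comp_def] using h'.comp _ hs
    simp [pd, fderiv_zero_of_not_differentiableAt hφ, fderiv_zero_of_not_differentiableAt hn]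

theorem pd_inl_comp_inr (φ : (ι → ℝ) → ℝ) (p : Unit ⊕ ι → ℝ) (u : Unit) :
    pd (Sum.inl u) (fun p => φ (p ∘ Sum.inr)) p = 0 := by
  by_cases h : DifferentiableAt ℝ (fun p : Unit ⊕ ι → ℝ => φ (p ∘ Sum.inr)) p
  · rw [pd, ← h.lineDeriv_eq_fderiv, lineDeriv]
    have : ∀ t : ℝ, (p + t • (Pi.single (Sum.inl u) 1 : Unit ⊕ ι → ℝ)) ∘ Sum.inr
        = p ∘ Sum.inr := by
      intro t; ext j; simp
    simp [this]
  · simp [pd, fderiv_zero_of_not_differentiableAt h]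

end Pullback

/-- The metric `φ (dx + A)² + g` in the coordinates `(x, b)`. -/
noncomputable def bundleMetric (φ : (ι → ℝ) → ℝ) (A : (ι → ℝ) → ι → ℝ)
    (g : (ι → ℝ) → Matrix ι ι ℝ) (p : Unit ⊕ ι → ℝ) : Matrix (Unit ⊕ ι) (Unit ⊕ ι) ℝ :=
  φ (p ∘ Sum.inr) •
      Matrix.vecMulVec (Sum.elim (fun _ => 1) (A (p ∘ Sum.inr)))
        (Sum.elim (fun _ => 1) (A (p ∘ Sum.inr))) +
    Matrix.fromBlocks 0 0 0 (g (p ∘ Sum.inr))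

/-- The curvature `dA`. -/
noncomputable def curl (A : (ι → ℝ) → ι → ℝ) (i j : ι) (x : ι → ℝ) : ℝ :=
  pd i (fun y => A y j) x - pd j (fun y => A y i) x

/-- The vector field metrically dual to a `1`-form. -/
noncomputable def sharp (g : (ι → ℝ) → Matrix ι ι ℝ) (A : (ι → ℝ) → ι → ℝ) (i : ι)
    (x : ι → ℝ) : ℝ :=
  ∑ j, (g x)⁻¹ i j * A x j

/-- The gradient of a function. -/
noncomputable def grad (g : (ι → ℝ) → Matrix ι ι ℝ) (f : (ι → ℝ) → ℝ) (i : ι) (x : ι → ℝ) : ℝ :=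
  ∑ j, (g x)⁻¹ i j * pd j f x

section Entries

variable (φ : (ι → ℝ) → ℝ) (A : (ι → ℝ) → ι → ℝ) (g : (ι → ℝ) → Matrix ι ι ℝ)
  (p : Unit ⊕ ι → ℝ) (u v : Unit) (i j : ι)

@[simp] theorem bundleMetric_inl_inl :
    bundleMetric φ A g p (Sum.inl u) (Sum.inl v) = φ (p ∘ Sum.inr) := by
  simp [bundleMetric, Matrix.vecMulVec_apply]

@[simp] theorem bundleMetric_inl_inr :
    bundleMetric φ A g p (Sum.inl u) (Sum.inr j) = φ (p ∘ Sum.inr) * A (p ∘ Sum.inr) j := by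
  simp [bundleMetric, Matrix.vecMulVec_apply]

@[simp] theorem bundleMetric_inr_inl :
    bundleMetric φ A g p (Sum.inr i) (Sum.inl v) = φ (p ∘ Sum.inr) * A (p ∘ Sum.inr) i := by
  simp [bundleMetric, Matrix.vecMulVec_apply]

@[simp] theorem bundleMetric_inr_inr :
    bundleMetric φ A g p (Sum.inr i) (Sum.inr j) =
      φ (p ∘ Sum.inr) * (A (p ∘ Sum.inr) i * A (p ∘ Sum.inr) j) + g (p ∘ Sum.inr) i j := by
  simp [bundleMetric, Matrix.vecMulVec_apply]

end Entries

/-- Smooth data on an open set for a metric `φ (dx + A)² + g`. -/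
structure IsBundleData (φ : (ι → ℝ) → ℝ) (A : (ι → ℝ) → ι → ℝ) (g : (ι → ℝ) → Matrix ι ι ℝ)
    (U : Set (ι → ℝ)) : Prop where
  isOpen : IsOpen U
  metric : IsMetricOn g U
  pos : ∀ x ∈ U, 0 < φ x
  smooth : ContDiffOn ℝ ∞ φ U
  smooth_form : ∀ i, ContDiffOn ℝ ∞ (fun x => A x i) U

namespace IsBundleData

variable {φ : (ι → ℝ) → ℝ} {A : (ι → ℝ) → ι → ℝ} {g : (ι → ℝ) → Matrix ι ι ℝ}
  {U : Set (ι → ℝ)}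

theorem isOpen_preimage (H : IsBundleData φ A g U) :
    IsOpen {p : Unit ⊕ ι → ℝ | p ∘ Sum.inr ∈ U} :=
  H.isOpen.preimage contDiff_comp_inr.continuous

theorem contDiffOn_comp_inr {f : (ι → ℝ) → ℝ} (hf : ContDiffOn ℝ ∞ f U) :
    ContDiffOn ℝ ∞ (fun p : Unit ⊕ ι → ℝ => f (p ∘ Sum.inr)) {p | p ∘ Sum.inr ∈ U} :=
  hf.comp contDiff_comp_inr.contDiffOn fun _ hp => hp

theorem posDef (H : IsBundleData φ A g U) {p : Unit ⊕ ι → ℝ} (hp : p ∘ Sum.inr ∈ U) :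
    (bundleMetric φ A g p).PosDef := by
  refine Matrix.PosDef.of_dotProduct_mulVec_pos ?_ fun x hx => ?_
  · ext (i | i) (j | j)
    · simp
    · simp
    · simp
    · simp [H.metric.symm hp i j, mul_comm (A _ i)]
  -- Completing the square. If the horizontal part of the vector vanishes, its fiber component does
  -- not, and the first term is positive.
  · have key : star x ⬝ᵥ (bundleMetric φ A g p).mulVec x =
        φ (p ∘ Sum.inr) * (x (Sum.inl ()) + ∑ i, A (p ∘ Sum.inr) i * x (Sum.inr i)) ^ 2 +
          star (x ∘ Sum.inr) ⬝ᵥ (g (p ∘ Sum.inr)).mulVec (x ∘ Sum.inr) := by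
      simp only [dotProduct, Matrix.mulVec, Fintype.sum_sum_type, Finset.univ_unique,
        Finset.sum_singleton, bundleMetric_inl_inl, bundleMetric_inl_inr, bundleMetric_inr_inl,
        bundleMetric_inr_inr, add_mul, Finset.sum_add_distrib, mul_add, star_trivial,
        Function.comp_apply]
      have e1 : ∑ j, φ (p ∘ Sum.inr) * A (p ∘ Sum.inr) j * x (Sum.inr j)
          = φ (p ∘ Sum.inr) * ∑ i, A (p ∘ Sum.inr) i * x (Sum.inr i) := by
        rw [Finset.mul_sum]; exact Finset.sum_congr rfl fun _ _ => by ring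
      have e2 : ∑ i, x (Sum.inr i) * (φ (p ∘ Sum.inr) * A (p ∘ Sum.inr) i * x (Sum.inl default))
          = φ (p ∘ Sum.inr) * (∑ i, A (p ∘ Sum.inr) i * x (Sum.inr i)) * x (Sum.inl ()) := by
        rw [Finset.mul_sum, Finset.sum_mul]; exact Finset.sum_congr rfl fun _ _ => by ring
      have e3 : ∑ i, x (Sum.inr i) * ∑ j,
            φ (p ∘ Sum.inr) * (A (p ∘ Sum.inr) i * A (p ∘ Sum.inr) j) * x (Sum.inr j)
          = φ (p ∘ Sum.inr) * (∑ i, A (p ∘ Sum.inr) i * x (Sum.inr i)) ^ 2 := by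
        rw [sq, Finset.sum_mul_sum, Finset.mul_sum]
        refine Finset.sum_congr rfl fun _ _ => ?_
        rw [Finset.mul_sum, Finset.mul_sum]
        exact Finset.sum_congr rfl fun _ _ => by ring
      rw [e1, e2, e3]
      simp only [PUnit.default_eq_unit]
      ring
    rw [key]
    have hφ := H.pos _ hp
    by_cases hr : x ∘ Sum.inr = 0
    · have hr' : ∀ i, x (Sum.inr i) = 0 := fun i => congrFun hr i
      have hl : x (Sum.inl ()) ≠ 0 := by
        intro h0
        apply hx
        ext (⟨⟩ | i)
        · exact h0
        · exact hr' i
      simp only [hr, hr', mul_zero, Finset.sum_const_zero, add_zero, star_zero, zero_dotProduct]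
      positivity
    · have := (H.metric.2 _ hp).dotProduct_mulVec_pos hr
      positivity

theorem isMetricOn (H : IsBundleData φ A g U) :
    IsMetricOn (bundleMetric φ A g) {p | p ∘ Sum.inr ∈ U} := by
  refine ⟨?_, fun p hp => H.posDef hp⟩
  have h1 := contDiffOn_comp_inr H.smooth
  have h2 := fun i => contDiffOn_comp_inr (H.smooth_form i)
  have h3 := fun i j => contDiffOn_comp_inr (H.metric.1 i j)
  rintro (i | i) (j | j)
  · simpa using h1
  · simpa using h1.mul (h2 j)
  · simpa using h1.mul (h2 i)
  · simpa using (h1.mul ((h2 i).mul (h2 j))).add (h3 i j)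

theorem sharp_symm (hg : IsMetricOn g U) {x : ι → ℝ} (hx : x ∈ U) (i : ι) :
    ∑ k, A x k * (g x)⁻¹ k i = sharp g A i x := by
  simp only [sharp]
  exact Finset.sum_congr rfl fun k _ => by rw [hg.inv_symm hx, mul_comm]

theorem sum_mul_sharp (hg : IsMetricOn g U) {x : ι → ℝ} (hx : x ∈ U) (i : ι) :
    ∑ k, g x i k * sharp g A k x = A x i := by
  simp only [sharp, Finset.mul_sum]
  rw [Finset.sum_comm]
  simp only [← mul_assoc, ← Finset.sum_mul, hg.sum_mul_inv hx]
  simp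

/-- The horizontal lifts ∂ᵢ - Aᵢ ∂ₓ are orthogonal to ∂ₓ, so the dual metric is φ⁻¹ ∂ₓ² + gⁱʲ (∂ᵢ -
Aᵢ ∂ₓ)(∂ⱼ - Aⱼ ∂ₓ); the blocks are its coefficients. -/
theorem inv_eq (H : IsBundleData φ A g U) {p : Unit ⊕ ι → ℝ} (hp : p ∘ Sum.inr ∈ U) :
    (bundleMetric φ A g p)⁻¹ = Matrix.fromBlocks
      (.of fun _ _ => 1 / φ (p ∘ Sum.inr) + ∑ i, A (p ∘ Sum.inr) i * sharp g A i (p ∘ Sum.inr))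
      (.of fun _ j => -sharp g A j (p ∘ Sum.inr)) (.of fun i _ => -sharp g A i (p ∘ Sum.inr))
      (g (p ∘ Sum.inr))⁻¹ := by
  apply Matrix.inv_eq_right_inv
  have hφ := (H.pos _ hp).ne'
  set y := p ∘ Sum.inr with hy
  ext (i | i) (j | j)
  · simp only [Matrix.mul_apply, Fintype.sum_sum_type, Finset.univ_unique, Finset.sum_singleton,
      bundleMetric_inl_inl, bundleMetric_inl_inr, Matrix.fromBlocks_apply₁₁,
      Matrix.fromBlocks_apply₂₁, Matrix.of_apply, ← hy, mul_assoc, mul_neg, Finset.sum_neg_distrib,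
      ← Finset.mul_sum]
    simp only [Matrix.one_apply_eq]
    field_simp
    ring
  · simp only [Matrix.mul_apply, Fintype.sum_sum_type, Finset.univ_unique, Finset.sum_singleton,
      bundleMetric_inl_inl, bundleMetric_inl_inr, Matrix.fromBlocks_apply₁₂,
      Matrix.fromBlocks_apply₂₂, Matrix.of_apply, ← hy, mul_assoc, ← Finset.mul_sum]
    rw [sharp_symm H.metric hp]
    simp
  · simp only [Matrix.mul_apply, Fintype.sum_sum_type, Finset.univ_unique, Finset.sum_singleton,
      bundleMetric_inr_inl, bundleMetric_inr_inr, Matrix.fromBlocks_apply₁₁,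
      Matrix.fromBlocks_apply₂₁, Matrix.of_apply, ← hy, mul_assoc, mul_neg, Finset.sum_neg_distrib,
      ← Finset.mul_sum, add_mul, Finset.sum_add_distrib, sum_mul_sharp H.metric hp]
    simp only [ne_eq, reduceCtorEq, not_false_eq_true, Matrix.one_apply_ne]
    field_simp
    ring
  · simp only [Matrix.mul_apply, Fintype.sum_sum_type, Finset.univ_unique, Finset.sum_singleton,
      bundleMetric_inr_inl, bundleMetric_inr_inr, Matrix.fromBlocks_apply₁₂,
      Matrix.fromBlocks_apply₂₂, Matrix.of_apply, ← hy, mul_assoc, ← Finset.mul_sum, add_mul,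
      Finset.sum_add_distrib, H.metric.sum_mul_inv hp]
    rw [sharp_symm H.metric hp]
    simp [Matrix.one_apply]

section InverseEntries

variable {p : Unit ⊕ ι → ℝ} {u v : Unit} {i j : ι}

theorem inv_inl_inl (H : IsBundleData φ A g U) (hp : p ∘ Sum.inr ∈ U) :
    (bundleMetric φ A g p)⁻¹ (Sum.inl u) (Sum.inl v) =
      1 / φ (p ∘ Sum.inr) + ∑ i, A (p ∘ Sum.inr) i * sharp g A i (p ∘ Sum.inr) := by
  rw [H.inv_eq hp]; rfl

theorem inv_inl_inr (H : IsBundleData φ A g U) (hp : p ∘ Sum.inr ∈ U) :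
    (bundleMetric φ A g p)⁻¹ (Sum.inl u) (Sum.inr j) = -sharp g A j (p ∘ Sum.inr) := by
  rw [H.inv_eq hp]; rfl

theorem inv_inr_inl (H : IsBundleData φ A g U) (hp : p ∘ Sum.inr ∈ U) :
    (bundleMetric φ A g p)⁻¹ (Sum.inr i) (Sum.inl v) = -sharp g A i (p ∘ Sum.inr) := by
  rw [H.inv_eq hp]; rfl

theorem inv_inr_inr (H : IsBundleData φ A g U) (hp : p ∘ Sum.inr ∈ U) :
    (bundleMetric φ A g p)⁻¹ (Sum.inr i) (Sum.inr j) = (g (p ∘ Sum.inr))⁻¹ i j := by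
  rw [H.inv_eq hp]; rfl

end InverseEntries

section PartialDerivatives

variable {p : Unit ⊕ ι → ℝ}

theorem pd_inl_bundleMetric (u : Unit) (I J : Unit ⊕ ι) :
    pd (Sum.inl u) (fun p => bundleMetric φ A g p I J) p = 0 := by
  -- The entries do not depend on x, so they can be read off on the slice x = 0.
  obtain ⟨f, hf⟩ : ∃ f : (ι → ℝ) → ℝ, ∀ p, bundleMetric φ A g p I J = f (p ∘ Sum.inr) :=
    ⟨fun y => bundleMetric φ A g (Sum.elim 0 y) I J, fun p => by
      rcases I with i | i <;> rcases J with j | j <;> simp⟩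
  simp only [hf]
  exact pd_inl_comp_inr f p u

theorem pd_inr_bundleMetric_inl_inl (k : ι) (u v : Unit) :
    pd (Sum.inr k) (fun p => bundleMetric φ A g p (Sum.inl u) (Sum.inl v)) p
      = pd k φ (p ∘ Sum.inr) := by
  simp only [bundleMetric_inl_inl]
  exact pd_inr_comp_inr φ p k

theorem pd_inr_bundleMetric_inl_inr (H : IsBundleData φ A g U) (hp : p ∘ Sum.inr ∈ U)
    (k : ι) (u : Unit) (j : ι) :
    pd (Sum.inr k) (fun p => bundleMetric φ A g p (Sum.inl u) (Sum.inr j)) p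
      = pd k φ (p ∘ Sum.inr) * A (p ∘ Sum.inr) j
        + φ (p ∘ Sum.inr) * pd k (fun y => A y j) (p ∘ Sum.inr) := by
  simp only [bundleMetric_inl_inr]
  rw [pd_inr_comp_inr (fun y => φ y * A y j) p k]
  exact pd_mul k (differentiableAt_of_contDiffOn H.isOpen H.smooth hp)
    (differentiableAt_of_contDiffOn H.isOpen (H.smooth_form j) hp)

theorem pd_inr_bundleMetric_inr_inl (H : IsBundleData φ A g U) (hp : p ∘ Sum.inr ∈ U)
    (k : ι) (u : Unit) (j : ι) :
    pd (Sum.inr k) (fun p => bundleMetric φ A g p (Sum.inr j) (Sum.inl u)) p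
      = pd k φ (p ∘ Sum.inr) * A (p ∘ Sum.inr) j
        + φ (p ∘ Sum.inr) * pd k (fun y => A y j) (p ∘ Sum.inr) := by
  rw [← H.pd_inr_bundleMetric_inl_inr hp k u j]
  simp

theorem pd_inr_bundleMetric_inr_inr (H : IsBundleData φ A g U) (hp : p ∘ Sum.inr ∈ U)
    (k i j : ι) :
    pd (Sum.inr k) (fun p => bundleMetric φ A g p (Sum.inr i) (Sum.inr j)) p
      = pd k φ (p ∘ Sum.inr) * (A (p ∘ Sum.inr) i * A (p ∘ Sum.inr) j)
        + φ (p ∘ Sum.inr) * (pd k (fun y => A y i) (p ∘ Sum.inr) * A (p ∘ Sum.inr) j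
          + A (p ∘ Sum.inr) i * pd k (fun y => A y j) (p ∘ Sum.inr))
        + pd k (fun y => g y i j) (p ∘ Sum.inr) := by
  simp only [bundleMetric_inr_inr]
  rw [pd_inr_comp_inr (fun y => φ y * (A y i * A y j) + g y i j) p k]
  have h1 := differentiableAt_of_contDiffOn H.isOpen H.smooth hp
  have h2 := fun i => differentiableAt_of_contDiffOn H.isOpen (H.smooth_form i) hp
  have h3 := differentiableAt_of_contDiffOn H.isOpen (H.metric.1 i j) hp
  rw [pd_add k (h1.fun_mul ((h2 i).fun_mul (h2 j))) h3, pd_mul k h1 ((h2 i).fun_mul (h2 j)),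
    pd_mul k (h2 i) (h2 j)]

end PartialDerivatives

/-! ### Christoffel symbols of the total space -/

section Christoffel

variable {p : Unit ⊕ ι → ℝ}

theorem christoffelLower_inl_inl_inl (u v w : Unit) :
    christoffelLower (bundleMetric φ A g) (Sum.inl u) (Sum.inl v) (Sum.inl w) p = 0 := by
  simp only [christoffelLower, pd_inl_bundleMetric]; ring

theorem christoffelLower_inr_inl_inl (l : ι) (v w : Unit) :
    christoffelLower (bundleMetric φ A g) (Sum.inr l) (Sum.inl v) (Sum.inl w) p
      = -(1 / 2) * pd l φ (p ∘ Sum.inr) := by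
  simp only [christoffelLower, pd_inl_bundleMetric, pd_inr_bundleMetric_inl_inl]; ring

theorem christoffelLower_inl_inl_inr (u v : Unit) (m : ι) :
    christoffelLower (bundleMetric φ A g) (Sum.inl u) (Sum.inl v) (Sum.inr m) p
      = (1 / 2) * pd m φ (p ∘ Sum.inr) := by
  simp only [christoffelLower, pd_inl_bundleMetric, pd_inr_bundleMetric_inl_inl]; ring

theorem christoffelLower_inr_inl_inr (H : IsBundleData φ A g U) (hp : p ∘ Sum.inr ∈ U)
    (l m : ι) (v : Unit) :
    christoffelLower (bundleMetric φ A g) (Sum.inr l) (Sum.inl v) (Sum.inr m) p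
      = (1 / 2) * (φ (p ∘ Sum.inr) * curl A m l (p ∘ Sum.inr)
        + A (p ∘ Sum.inr) l * pd m φ (p ∘ Sum.inr)
        - A (p ∘ Sum.inr) m * pd l φ (p ∘ Sum.inr)) := by
  simp only [christoffelLower, pd_inl_bundleMetric, H.pd_inr_bundleMetric_inl_inr hp, curl]
  ring

theorem sum_mul_grad_comm (hg : IsMetricOn g U) {x : ι → ℝ} (hx : x ∈ U) :
    ∑ l, sharp g A l x * pd l φ x = ∑ l, A x l * grad g φ l x := by
  simp only [sharp, grad, Finset.sum_mul, Finset.mul_sum]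
  rw [Finset.sum_comm]
  refine Finset.sum_congr rfl fun _ _ => Finset.sum_congr rfl fun _ _ => ?_
  rw [hg.inv_symm hx]; ring

theorem christoffel_inr_inl_inl (H : IsBundleData φ A g U) (hp : p ∘ Sum.inr ∈ U)
    (k : ι) (v w : Unit) :
    christoffel (bundleMetric φ A g) (Sum.inr k) (Sum.inl v) (Sum.inl w) p
      = -(1 / 2) * grad g φ k (p ∘ Sum.inr) := by
  simp only [christoffel_eq_sum, H.inv_inr_inl hp, H.inv_inr_inr hp, Fintype.sum_sum_type, Finset.univ_unique,
    Finset.sum_singleton, christoffelLower_inl_inl_inl, christoffelLower_inr_inl_inl, grad, Finset.mul_sum]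
  simp only [mul_zero, zero_add]
  exact Finset.sum_congr rfl fun _ _ => by ring

theorem christoffel_inl_inl_inl (H : IsBundleData φ A g U) (hp : p ∘ Sum.inr ∈ U)
    (u v w : Unit) :
    christoffel (bundleMetric φ A g) (Sum.inl u) (Sum.inl v) (Sum.inl w) p
      = (1 / 2) * ∑ l, A (p ∘ Sum.inr) l * grad g φ l (p ∘ Sum.inr) := by
  rw [← sum_mul_grad_comm H.metric hp]
  simp only [christoffel_eq_sum, H.inv_inl_inl hp, H.inv_inl_inr hp, Fintype.sum_sum_type, Finset.univ_unique,
    Finset.sum_singleton, christoffelLower_inl_inl_inl, christoffelLower_inr_inl_inl, Finset.mul_sum]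
  simp only [mul_zero, zero_add]
  exact Finset.sum_congr rfl fun _ _ => by ring

theorem christoffel_inr_inl_inr (H : IsBundleData φ A g U) (hp : p ∘ Sum.inr ∈ U)
    (k m : ι) (v : Unit) :
    christoffel (bundleMetric φ A g) (Sum.inr k) (Sum.inl v) (Sum.inr m) p
      = (1 / 2) * (φ (p ∘ Sum.inr) * ∑ l, (g (p ∘ Sum.inr))⁻¹ k l * curl A m l (p ∘ Sum.inr)
        - A (p ∘ Sum.inr) m * grad g φ k (p ∘ Sum.inr)) := by
  simp only [christoffel_eq_sum, H.inv_inr_inl hp, H.inv_inr_inr hp, Fintype.sum_sum_type, Finset.univ_unique,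
    Finset.sum_singleton, christoffelLower_inl_inl_inr, H.christoffelLower_inr_inl_inr hp]
  set y := p ∘ Sum.inr
  have : ∀ l, (g y)⁻¹ k l * (1 / 2 * (φ y * curl A m l y + A y l * pd m φ y - A y m * pd l φ y))
      = 1 / 2 * (φ y * ((g y)⁻¹ k l * curl A m l y)) + 1 / 2 * pd m φ y * ((g y)⁻¹ k l * A y l)
        - 1 / 2 * A y m * ((g y)⁻¹ k l * pd l φ y) := fun l => by ring
  simp only [this, Finset.sum_sub_distrib, Finset.sum_add_distrib, ← Finset.mul_sum, sharp, grad]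
  ring

theorem christoffel_inl_inl_inr (H : IsBundleData φ A g U) (hp : p ∘ Sum.inr ∈ U)
    (m : ι) (u v : Unit) :
    christoffel (bundleMetric φ A g) (Sum.inl u) (Sum.inl v) (Sum.inr m) p
      = (1 / 2) * (pd m φ (p ∘ Sum.inr) / φ (p ∘ Sum.inr)
        - φ (p ∘ Sum.inr) * ∑ l, sharp g A l (p ∘ Sum.inr) * curl A m l (p ∘ Sum.inr)
        + A (p ∘ Sum.inr) m * ∑ l, A (p ∘ Sum.inr) l * grad g φ l (p ∘ Sum.inr)) := by
  rw [← sum_mul_grad_comm H.metric hp]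
  simp only [christoffel_eq_sum, H.inv_inl_inl hp, H.inv_inl_inr hp, Fintype.sum_sum_type, Finset.univ_unique,
    Finset.sum_singleton, christoffelLower_inl_inl_inr, H.christoffelLower_inr_inl_inr hp]
  set y := p ∘ Sum.inr
  have : ∀ l, -sharp g A l y *
        (1 / 2 * (φ y * curl A m l y + A y l * pd m φ y - A y m * pd l φ y))
      = -(1 / 2) * φ y * (sharp g A l y * curl A m l y) - 1 / 2 * pd m φ y * (A y l * sharp g A l y)
        + 1 / 2 * A y m * (sharp g A l y * pd l φ y) := fun l => by ring
  simp only [this, Finset.sum_sub_distrib, Finset.sum_add_distrib, ← Finset.mul_sum]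
  ring

theorem sum_christoffel_inl (H : IsBundleData φ A g U) (hp : p ∘ Sum.inr ∈ U) (u : Unit) :
    ∑ K, christoffel (bundleMetric φ A g) K K (Sum.inl u) p = 0 := by
  rw [H.isMetricOn.sum_christoffel H.isOpen_preimage hp]
  simp [pd_inl_bundleMetric]

/-- The trace of the Christoffel symbols is the derivative of log √det, and the total metric has
determinant φ det g. The proof checks this through g⁻¹ ∂g, where all terms in A cancel. -/
theorem sum_christoffel_inr (H : IsBundleData φ A g U) (hp : p ∘ Sum.inr ∈ U) (m : ι) :
    ∑ K, christoffel (bundleMetric φ A g) K K (Sum.inr m) p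
      = ∑ k, christoffel g k k m (p ∘ Sum.inr)
        + (1 / 2) * (pd m φ (p ∘ Sum.inr) / φ (p ∘ Sum.inr)) := by
  rw [H.isMetricOn.sum_christoffel H.isOpen_preimage hp, H.metric.sum_christoffel H.isOpen hp]
  have hφ := (H.pos _ hp).ne'
  simp only [H.inv_inl_inl hp, H.inv_inl_inr hp, H.inv_inr_inl hp, H.inv_inr_inr hp,
    Fintype.sum_sum_type, Finset.univ_unique,
    Finset.sum_singleton, pd_inr_bundleMetric_inl_inl, H.pd_inr_bundleMetric_inl_inr hp,
    H.pd_inr_bundleMetric_inr_inl hp, H.pd_inr_bundleMetric_inr_inr hp]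
  set y := p ∘ Sum.inr
  have e1 : ∀ k, -sharp g A k y * (pd m φ y * A y k + φ y * pd m (fun y => A y k) y)
      = -pd m φ y * (A y k * sharp g A k y) - φ y * (sharp g A k y * pd m (fun y => A y k) y) :=
    fun k => by ring
  have e2 : ∑ k, ∑ l, (g y)⁻¹ k l * (pd m φ y * (A y k * A y l)
        + φ y * (pd m (fun y => A y k) y * A y l + A y k * pd m (fun y => A y l) y)
        + pd m (fun y => g y k l) y)
      = pd m φ y * (∑ k, A y k * sharp g A k y)
        + 2 * φ y * (∑ k, sharp g A k y * pd m (fun y => A y k) y)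
        + ∑ k, ∑ l, (g y)⁻¹ k l * pd m (fun y => g y k l) y := by
    have e3 : ∑ k, ∑ l, (g y)⁻¹ k l * (A y k * A y l) = ∑ k, A y k * sharp g A k y := by
      simp only [sharp, Finset.mul_sum]
      exact Finset.sum_congr rfl fun _ _ => Finset.sum_congr rfl fun _ _ => by ring
    have e4 : ∑ k, ∑ l, (g y)⁻¹ k l * (pd m (fun y => A y k) y * A y l)
        = ∑ k, sharp g A k y * pd m (fun y => A y k) y := by
      simp only [sharp, Finset.sum_mul]
      exact Finset.sum_congr rfl fun _ _ => Finset.sum_congr rfl fun _ _ => by ring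
    have e5 : ∑ k, ∑ l, (g y)⁻¹ k l * (A y k * pd m (fun y => A y l) y)
        = ∑ k, sharp g A k y * pd m (fun y => A y k) y := by
      rw [← e4, Finset.sum_comm]
      refine Finset.sum_congr rfl fun _ _ => Finset.sum_congr rfl fun _ _ => ?_
      rw [H.metric.inv_symm hp]; ring
    have e6 : ∀ k l, (g y)⁻¹ k l * (pd m φ y * (A y k * A y l)
          + φ y * (pd m (fun y => A y k) y * A y l + A y k * pd m (fun y => A y l) y)
          + pd m (fun y => g y k l) y)
        = pd m φ y * ((g y)⁻¹ k l * (A y k * A y l))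
          + φ y * ((g y)⁻¹ k l * (pd m (fun y => A y k) y * A y l))
          + φ y * ((g y)⁻¹ k l * (A y k * pd m (fun y => A y l) y))
          + (g y)⁻¹ k l * pd m (fun y => g y k l) y := fun k l => by ring
    simp only [e6, Finset.sum_add_distrib, ← Finset.mul_sum, e3, e4, e5]
    ring
  rw [Finset.sum_add_distrib, e2]
  simp only [e1, Finset.sum_sub_distrib, ← Finset.mul_sum]
  field_simp
  ring

end Christoffel

end IsBundleData

/-! ### Positivity of the norm of the curvature form -/

/-- The squared norm `Fᵢⱼ Fⁱʲ` of the curvature `F = dA`. -/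
noncomputable def curlNormSq (A : (ι → ℝ) → ι → ℝ) (g : (ι → ℝ) → Matrix ι ι ℝ) (x : ι → ℝ) : ℝ :=
  ∑ k, ∑ m, (∑ l, (g x)⁻¹ k l * curl A m l x) * ∑ j, (g x)⁻¹ m j * -curl A k j x

theorem curl_antisymm (A : (ι → ℝ) → ι → ℝ) (i j : ι) (x : ι → ℝ) :
    curl A i j x = -curl A j i x := by
  simp [curl]

open scoped MatrixOrder in
-- Applied to the inverse metric, `C` expresses covariant tensors in an orthonormal frame.
theorem exists_eq_transpose_mul_self {h : Matrix ι ι ℝ} (hh : h.PosDef) :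
    ∃ C : Matrix ι ι ℝ, IsUnit C.det ∧ h = C.transpose * C := by
  obtain ⟨C, hC⟩ := CStarAlgebra.nonneg_iff_eq_star_mul_self.mp hh.posSemidef.nonneg
  have hC' : h = C.transpose * C := by
    simpa [Matrix.star_eq_conjTranspose, Matrix.conjTranspose_eq_transpose_of_trivial] using hC
  have := hh.det_pos.ne'
  rw [hC', Matrix.det_mul] at this
  exact ⟨C, isUnit_iff_ne_zero.2 (right_ne_zero_of_mul this), hC'⟩

/-- With h = CᵀC the trace is the sum of the squared entries of C M Cᵀ, and C is invertible. -/
theorem trace_mul_mul_mul_transpose {h M : Matrix ι ι ℝ} (hh : h.PosDef) :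
    0 ≤ (h * M * h * M.transpose).trace ∧ ((h * M * h * M.transpose).trace = 0 → M = 0) := by
  obtain ⟨C, hdet, hC'⟩ := exists_eq_transpose_mul_self hh
  have key : (h * M * h * M.transpose).trace
      = ((C * M * C.transpose).conjTranspose * (C * M * C.transpose)).trace := by
    rw [hC', Matrix.trace_mul_comm _ (C * M * C.transpose)]
    simp only [Matrix.conjTranspose_eq_transpose_of_trivial, Matrix.transpose_mul,
      Matrix.transpose_transpose]
    rw [show C.transpose * C * M * (C.transpose * C) * M.transpose
      = C.transpose * (C * M * C.transpose * C * M.transpose) by simp only [Matrix.mul_assoc],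
      Matrix.trace_mul_comm]
    simp only [Matrix.mul_assoc]
  rw [key]
  refine ⟨(Matrix.posSemidef_conjTranspose_mul_self _).trace_nonneg, fun h0 => ?_⟩
  have h1 := Matrix.trace_conjTranspose_mul_self_eq_zero_iff.1 h0
  have hT : IsUnit C.transpose.det := by simpa using hdet
  calc M = C⁻¹ * (C * M * C.transpose) * C.transpose⁻¹ := by
        rw [Matrix.mul_assoc C⁻¹, Matrix.mul_nonsing_inv_cancel_right _ _ hT,
          Matrix.nonsing_inv_mul_cancel_left _ _ hdet]
    _ = 0 := by rw [h1]; simp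

section CurlNorm

variable {A : (ι → ℝ) → ι → ℝ} {g : (ι → ℝ) → Matrix ι ι ℝ} {U : Set (ι → ℝ)} {x : ι → ℝ}

theorem curlNormSq_eq_trace (A : (ι → ℝ) → ι → ℝ) (g : (ι → ℝ) → Matrix ι ι ℝ) (x : ι → ℝ) :
    curlNormSq A g x = ((g x)⁻¹ * Matrix.of (fun i j => curl A i j x) * (g x)⁻¹ *
      (Matrix.of fun i j => curl A i j x).transpose).trace := by
  rw [Matrix.mul_assoc]
  simp only [Matrix.trace, Matrix.diag, Matrix.mul_apply, Matrix.of_apply, Matrix.transpose_apply,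
    curlNormSq]
  refine Finset.sum_congr rfl fun k _ => Finset.sum_congr rfl fun m _ => ?_
  -- Moving the sign to the other factor and using antisymmetry there puts the indices in the order
  -- of the matrix product.
  rw [← neg_mul_neg]
  simp only [← Finset.sum_neg_distrib, ← mul_neg, ← curl_antisymm]

theorem curlNormSq_nonneg (hg : IsMetricOn g U) (hx : x ∈ U) : 0 ≤ curlNormSq A g x := by
  rw [curlNormSq_eq_trace]
  exact (trace_mul_mul_mul_transpose (hg.2 x hx).inv).1

theorem curl_eq_zero_of_curlNormSq (hg : IsMetricOn g U) (hx : x ∈ U)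
    (h : curlNormSq A g x = 0) (i j : ι) : curl A i j x = 0 := by
  rw [curlNormSq_eq_trace] at h
  exact congrFun (congrFun ((trace_mul_mul_mul_transpose (hg.2 x hx).inv).2 h) i) j

theorem sum_grad_mul_pd_nonneg (hg : IsMetricOn g U) (hx : x ∈ U) (φ : (ι → ℝ) → ℝ) :
    0 ≤ ∑ k, pd k φ x * grad g φ k x := by
  have := (hg.2 x hx).inv.posSemidef.dotProduct_mulVec_nonneg fun k => pd k φ x
  simpa only [dotProduct, Matrix.mulVec, star_trivial, grad] using this

end CurlNorm

/-! ### Ricci curvature of the total space along the fibers -/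

namespace IsBundleData

variable {φ : (ι → ℝ) → ℝ} {A : (ι → ℝ) → ι → ℝ} {g : (ι → ℝ) → Matrix ι ι ℝ}
  {U : Set (ι → ℝ)} {p : Unit ⊕ ι → ℝ}

/-- This is the term Γᴵₓₘ Γᴹₓᵢ of Ric(∂ₓ, ∂ₓ). The gauge-dependent quantities `a` = A(grad φ) and
`T` cancel: a² enters with coefficients ¼ - ½ + ¼, and φT with ½ - ½, from the fiber, mixed and base
blocks. -/
theorem sum_christoffel_mul_christoffel (H : IsBundleData φ A g U) (hp : p ∘ Sum.inr ∈ U)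
    (u : Unit) :
    ∑ I, ∑ M, christoffel (bundleMetric φ A g) I (Sum.inl u) M p *
        christoffel (bundleMetric φ A g) M (Sum.inl u) I p
      = -(1 / 2) * (∑ k, pd k φ (p ∘ Sum.inr) * grad g φ k (p ∘ Sum.inr)) / φ (p ∘ Sum.inr)
        - (1 / 4) * φ (p ∘ Sum.inr) ^ 2 * curlNormSq A g (p ∘ Sum.inr) := by
  simp only [Fintype.sum_sum_type, Finset.univ_unique, Finset.sum_singleton,
    H.christoffel_inl_inl_inl hp, H.christoffel_inr_inl_inl hp, H.christoffel_inl_inl_inr hp,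
    H.christoffel_inr_inl_inr hp, Finset.sum_add_distrib]
  have hφ := (H.pos _ hp).ne'
  set y := p ∘ Sum.inr
  set a := ∑ l, A y l * grad g φ l y with ha
  set T := ∑ m, (∑ l, sharp g A l y * curl A m l y) * grad g φ m y with hT
  have e1 : ∑ m, 1 / 2 * (pd m φ y / φ y - φ y * ∑ l, sharp g A l y * curl A m l y + A y m * a) *
        (-(1 / 2) * grad g φ m y)
      = -(1 / 4) * ((∑ k, pd k φ y * grad g φ k y) / φ y - φ y * T + a * a) := by
    nth_rewrite 3 [ha]
    rw [hT, Finset.sum_div, Finset.mul_sum, Finset.sum_mul, ← Finset.sum_sub_distrib,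
      ← Finset.sum_add_distrib, Finset.mul_sum]
    exact Finset.sum_congr rfl fun _ _ => by ring
  have e2 : ∑ m, -(1 / 2) * grad g φ m y *
        (1 / 2 * (pd m φ y / φ y - φ y * ∑ l, sharp g A l y * curl A m l y + A y m * a))
      = -(1 / 4) * ((∑ k, pd k φ y * grad g φ k y) / φ y - φ y * T + a * a) := by
    rw [← e1]; exact Finset.sum_congr rfl fun _ _ => by ring
  have e3 : ∑ k, ∑ m, (∑ l, (g y)⁻¹ k l * curl A m l y) * (A y k * grad g φ m y) = T := by
    rw [hT, Finset.sum_comm]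
    refine Finset.sum_congr rfl fun m _ => ?_
    simp only [sharp, Finset.sum_mul]
    rw [Finset.sum_comm]
    refine Finset.sum_congr rfl fun k _ => Finset.sum_congr rfl fun l _ => ?_
    rw [H.metric.inv_symm hp]; ring
  have e4 : ∑ k, ∑ m, (A y m * grad g φ k y) * (∑ j, (g y)⁻¹ m j * curl A k j y) = T := by
    rw [← e3, Finset.sum_comm]
    exact Finset.sum_congr rfl fun _ _ => Finset.sum_congr rfl fun _ _ => by ring
  have e5 : ∑ k, ∑ m, (∑ l, (g y)⁻¹ k l * curl A m l y) * (∑ j, (g y)⁻¹ m j * curl A k j y)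
      = -curlNormSq A g y := by
    simp only [curlNormSq, mul_neg, Finset.sum_neg_distrib, neg_neg]
  have e6 : ∑ k, ∑ m, (A y m * grad g φ k y) * (A y k * grad g φ m y) = a * a := by
    rw [ha, Finset.sum_mul_sum]
    exact Finset.sum_congr rfl fun _ _ => Finset.sum_congr rfl fun _ _ => by ring
  have e7 : ∀ k m, 1 / 2 * (φ y * ∑ l, (g y)⁻¹ k l * curl A m l y - A y m * grad g φ k y) *
        (1 / 2 * (φ y * ∑ l, (g y)⁻¹ m l * curl A k l y - A y k * grad g φ m y))
      = (1 / 4) * (φ y ^ 2 * ((∑ l, (g y)⁻¹ k l * curl A m l y) * (∑ j, (g y)⁻¹ m j * curl A k j y))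
        - φ y * ((∑ l, (g y)⁻¹ k l * curl A m l y) * (A y k * grad g φ m y))
        - φ y * ((A y m * grad g φ k y) * (∑ j, (g y)⁻¹ m j * curl A k j y))
        + (A y m * grad g φ k y) * (A y k * grad g φ m y)) := fun k m => by ring
  rw [e1, e2]
  simp only [e7, ← Finset.mul_sum, Finset.sum_add_distrib, Finset.sum_sub_distrib, e3, e4, e5, e6]
  ring

/-- The Ricci curvature of the total space in the direction of the fibers. -/
theorem ricci_inl_inl (H : IsBundleData φ A g U) (hp : p ∘ Sum.inr ∈ U) (u : Unit) :
    ricci (bundleMetric φ A g) (Sum.inl u) (Sum.inl u) p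
      = -(1 / 2) * laplacian g φ (p ∘ Sum.inr)
        + (1 / 4) * (∑ k, pd k φ (p ∘ Sum.inr) * grad g φ k (p ∘ Sum.inr)) / φ (p ∘ Sum.inr)
        + (1 / 4) * φ (p ∘ Sum.inr) ^ 2 * curlNormSq A g (p ∘ Sum.inr) := by
  have hopen := H.isOpen_preimage
  have hgrad : ∀ k, ContDiffOn ℝ ∞ (grad g φ k) U := fun k =>
    ContDiffOn.sum fun j _ => (H.metric.contDiffOn_inv k j).mul (contDiffOn_pd H.isOpen H.smooth j)
  have h1 : ∑ I, pd I (christoffel (bundleMetric φ A g) I (Sum.inl u) (Sum.inl u)) p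
      = -(1 / 2) * ∑ k, pd k (grad g φ k) (p ∘ Sum.inr) := by
    rw [Fintype.sum_sum_type, Finset.mul_sum]
    simp only [Finset.univ_unique, Finset.sum_singleton]
    rw [pd_congr _ hopen hp fun q hq => H.christoffel_inl_inl_inl hq _ u u,
      pd_inl_comp_inr (fun y => 1 / 2 * ∑ l, A y l * grad g φ l y), zero_add]
    refine Finset.sum_congr rfl fun k _ => ?_
    rw [pd_congr _ hopen hp fun q hq => H.christoffel_inr_inl_inl hq k u u,
      pd_inr_comp_inr (fun y => -(1 / 2) * grad g φ k y),
      pd_const_mul _ _ (differentiableAt_of_contDiffOn H.isOpen (hgrad k) hp)]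
  have h2 : ∀ I, pd (Sum.inl u) (christoffel (bundleMetric φ A g) I I (Sum.inl u)) p = 0 := by
    rintro (i | i)
    · rw [pd_congr _ hopen hp fun q hq => H.christoffel_inl_inl_inl hq i i u]
      exact pd_inl_comp_inr (fun y => 1 / 2 * ∑ l, A y l * grad g φ l y) p u
    · rw [pd_congr _ hopen hp fun q hq => (H.isMetricOn.christoffel_symm hopen hq _ _ _).trans
        (H.christoffel_inr_inl_inr hq i i u)]
      exact pd_inl_comp_inr (fun y => 1 / 2 * (φ y * ∑ l, (g y)⁻¹ i l * curl A i l y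
        - A y i * grad g φ i y)) p u
  have h3 : ∑ I, ∑ M, christoffel (bundleMetric φ A g) I I M p *
        christoffel (bundleMetric φ A g) M (Sum.inl u) (Sum.inl u) p
      = -(1 / 2) * ∑ m, (∑ k, christoffel g k k m (p ∘ Sum.inr)) * grad g φ m (p ∘ Sum.inr)
        - (1 / 4) * (∑ k, pd k φ (p ∘ Sum.inr) * grad g φ k (p ∘ Sum.inr)) / φ (p ∘ Sum.inr) := by
    rw [Finset.sum_comm]
    simp only [← Finset.sum_mul]
    rw [Fintype.sum_sum_type]
    simp only [H.sum_christoffel_inl hp, H.sum_christoffel_inr hp, H.christoffel_inr_inl_inl hp,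
      zero_mul, Finset.sum_const_zero, zero_add]
    rw [Finset.mul_sum, Finset.mul_sum, Finset.sum_div, ← Finset.sum_sub_distrib]
    exact Finset.sum_congr rfl fun _ _ => by ring
  have h4 := H.sum_christoffel_mul_christoffel hp u
  -- The divergence in `h1` and the trace term in `h3` combine to -½ △φ. The coefficient of |dφ|²/φ
  -- is -¼ from `h3` plus ½ from `h4`, which enters with a minus sign.
  have h5 : laplacian g φ (p ∘ Sum.inr) = ∑ k, pd k (grad g φ k) (p ∘ Sum.inr)
      + ∑ m, (∑ k, christoffel g k k m (p ∘ Sum.inr)) * grad g φ m (p ∘ Sum.inr) :=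
    H.metric.laplacian_eq H.isOpen hp H.smooth
  have h6 : ∀ I M, christoffel (bundleMetric φ A g) M I (Sum.inl u) p
      = christoffel (bundleMetric φ A g) M (Sum.inl u) I p := fun I M =>
    H.isMetricOn.christoffel_symm hopen hp _ _ _
  simp only [ricci, riemann, h2, h6, Finset.sum_add_distrib, Finset.sum_sub_distrib, h1, h3, h4, h5,
    Finset.sum_const_zero]
  ring

/-! ### Flat connection and fibers of constant length -/

theorem pd_form_symm (hF : ∀ y ∈ U, ∀ i j, curl A i j y = 0) {y : ι → ℝ} (hy : y ∈ U) (i j : ι) :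
    pd i (fun y => A y j) y = pd j (fun y => A y i) y :=
  sub_eq_zero.1 (hF y hy i j)

/-- The field ∂ₓ is parallel: it is Killing, and its dual form φ (dx + A) is closed. -/
theorem christoffel_inl_left (H : IsBundleData φ A g U) (hφ : ∀ y ∈ U, ∀ i, pd i φ y = 0)
    (hF : ∀ y ∈ U, ∀ i j, curl A i j y = 0) (hp : p ∘ Sum.inr ∈ U) (K M : Unit ⊕ ι) (u : Unit) :
    christoffel (bundleMetric φ A g) K (Sum.inl u) M p = 0 := by
  have hgrad : ∀ k, grad g φ k (p ∘ Sum.inr) = 0 := fun k => by simp [grad, hφ _ hp]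
  rcases K with k | k <;> rcases M with m | m
  · simp [H.christoffel_inl_inl_inl hp, hgrad]
  · simp [H.christoffel_inl_inl_inr hp, hgrad, hφ _ hp, hF _ hp]
  · simp [H.christoffel_inr_inl_inl hp, hgrad]
  · simp [H.christoffel_inr_inl_inr hp, hgrad, hF _ hp]

theorem christoffel_inl_right (H : IsBundleData φ A g U) (hφ : ∀ y ∈ U, ∀ i, pd i φ y = 0)
    (hF : ∀ y ∈ U, ∀ i j, curl A i j y = 0) (hp : p ∘ Sum.inr ∈ U) (K M : Unit ⊕ ι) (u : Unit) :
    christoffel (bundleMetric φ A g) K M (Sum.inl u) p = 0 := by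
  rw [H.isMetricOn.christoffel_symm H.isOpen_preimage hp, H.christoffel_inl_left hφ hF hp]

theorem christoffelLower_inl_inr_inr (H : IsBundleData φ A g U) (hφ : ∀ y ∈ U, ∀ i, pd i φ y = 0)
    (hF : ∀ y ∈ U, ∀ i j, curl A i j y = 0) (hp : p ∘ Sum.inr ∈ U) (u : Unit) (i j : ι) :
    christoffelLower (bundleMetric φ A g) (Sum.inl u) (Sum.inr i) (Sum.inr j) p
      = φ (p ∘ Sum.inr) * pd i (fun y => A y j) (p ∘ Sum.inr) := by
  simp only [christoffelLower, pd_inl_bundleMetric, H.pd_inr_bundleMetric_inr_inl hp, hφ _ hp]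
  rw [pd_form_symm hF hp j i]
  ring

theorem christoffelLower_inr_inr_inr (H : IsBundleData φ A g U) (hφ : ∀ y ∈ U, ∀ i, pd i φ y = 0)
    (hF : ∀ y ∈ U, ∀ i j, curl A i j y = 0) (hp : p ∘ Sum.inr ∈ U) (l i j : ι) :
    christoffelLower (bundleMetric φ A g) (Sum.inr l) (Sum.inr i) (Sum.inr j) p
      = christoffelLower g l i j (p ∘ Sum.inr)
        + A (p ∘ Sum.inr) l * (φ (p ∘ Sum.inr) * pd i (fun y => A y j) (p ∘ Sum.inr)) := by
  simp only [christoffelLower, H.pd_inr_bundleMetric_inr_inr hp, hφ _ hp]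
  rw [pd_form_symm hF hp j i, pd_form_symm hF hp i l, pd_form_symm hF hp j l]
  ring

/-- The extra term of the lowered symbol, Aₗ times its fiber component, cancels against the
off-diagonal block -A♯ of the inverse metric. -/
theorem christoffel_inr_inr_inr (H : IsBundleData φ A g U) (hφ : ∀ y ∈ U, ∀ i, pd i φ y = 0)
    (hF : ∀ y ∈ U, ∀ i j, curl A i j y = 0) (hp : p ∘ Sum.inr ∈ U) (k i j : ι) :
    christoffel (bundleMetric φ A g) (Sum.inr k) (Sum.inr i) (Sum.inr j) p
      = christoffel g k i j (p ∘ Sum.inr) := by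
  simp only [christoffel_eq_sum, Fintype.sum_sum_type, Finset.univ_unique, Finset.sum_singleton,
    H.inv_inr_inl hp, H.inv_inr_inr hp, H.christoffelLower_inl_inr_inr hφ hF hp,
    H.christoffelLower_inr_inr_inr hφ hF hp, mul_add, Finset.sum_add_distrib, ← mul_assoc,
    ← Finset.sum_mul, sharp]
  ring

/-- The symbols Γˣᵢⱼ need not vanish when A ≠ 0, but the Ricci tensor involves them only through
their x-derivative. -/
theorem pd_inl_christoffel (H : IsBundleData φ A g U) (hφ : ∀ y ∈ U, ∀ i, pd i φ y = 0)
    (hF : ∀ y ∈ U, ∀ i j, curl A i j y = 0) (hp : p ∘ Sum.inr ∈ U) (u v : Unit) (i j : ι) :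
    pd (Sum.inl v) (christoffel (bundleMetric φ A g) (Sum.inl u) (Sum.inr i) (Sum.inr j)) p
      = 0 := by
  obtain ⟨f, hf⟩ : ∃ f : (ι → ℝ) → ℝ, ∀ q : Unit ⊕ ι → ℝ, q ∘ Sum.inr ∈ U →
      christoffel (bundleMetric φ A g) (Sum.inl u) (Sum.inr i) (Sum.inr j) q
        = f (q ∘ Sum.inr) := by
    refine ⟨fun y => (1 / φ y + ∑ i, A y i * sharp g A i y) * (φ y * pd i (fun y => A y j) y)
      + ∑ l, -sharp g A l y * (christoffelLower g l i j y
        + A y l * (φ y * pd i (fun y => A y j) y)), fun q hq => ?_⟩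
    simp only [christoffel_eq_sum, Fintype.sum_sum_type, Finset.univ_unique, Finset.sum_singleton,
      H.inv_inl_inl hq, H.inv_inl_inr hq, H.christoffelLower_inl_inr_inr hφ hF hq,
      H.christoffelLower_inr_inr_inr hφ hF hq]
  rw [pd_congr _ H.isOpen_preimage hp hf]
  exact pd_inl_comp_inr f p v

/-- For a flat connection and fibers of constant length, the horizontal Ricci curvature is that
of the base. -/
theorem ricci_inr_inr (H : IsBundleData φ A g U) (hφ : ∀ y ∈ U, ∀ i, pd i φ y = 0)
    (hF : ∀ y ∈ U, ∀ i j, curl A i j y = 0) (hp : p ∘ Sum.inr ∈ U) (j k : ι) :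
    ricci (bundleMetric φ A g) (Sum.inr j) (Sum.inr k) p = ricci g j k (p ∘ Sum.inr) := by
  have hopen := H.isOpen_preimage
  have h1 : ∀ a i j k, pd (Sum.inr a)
        (christoffel (bundleMetric φ A g) (Sum.inr i) (Sum.inr j) (Sum.inr k)) p
      = pd a (christoffel g i j k) (p ∘ Sum.inr) := by
    intro a i j k
    rw [pd_congr _ hopen hp fun q hq => H.christoffel_inr_inr_inr hφ hF hq i j k]
    exact pd_inr_comp_inr _ p a
  have h2 : ∀ u v, pd (Sum.inr j)
      (christoffel (bundleMetric φ A g) (Sum.inl u) (Sum.inl v) (Sum.inr k)) p = 0 := by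
    intro u v
    rw [pd_congr _ hopen hp fun q hq => H.christoffel_inl_left hφ hF hq _ _ v, pd_const]
  simp only [ricci, riemann, Fintype.sum_sum_type, Finset.univ_unique, Finset.sum_singleton, h1, h2,
    H.pd_inl_christoffel hφ hF hp, H.christoffel_inl_left hφ hF hp,
    H.christoffel_inl_right hφ hF hp, H.christoffel_inr_inr_inr hφ hF hp]
  simp

end IsBundleData

/-! ### Curvature symmetries and dimension three -/

namespace IsMetricOn

variable {g : (ι → ℝ) → Matrix ι ι ℝ} {U : Set (ι → ℝ)} {x : ι → ℝ}

/-- Both sides are the inner product of ∇ᵢ∂ₗ and ∇ⱼ∂ₖ. -/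
theorem sum_christoffelLower_mul_comm (hg : IsMetricOn g U) (hx : x ∈ U) (i j k l : ι) :
    ∑ m, christoffelLower g m i l x * christoffel g m j k x
      = ∑ m, christoffelLower g m j k x * christoffel g m i l x := by
  simp only [← hg.sum_mul_christoffel hx, Finset.sum_mul]
  rw [Finset.sum_comm]
  refine Finset.sum_congr rfl fun _ _ => Finset.sum_congr rfl fun _ _ => ?_
  rw [hg.symm hx]; ring

theorem sum_mul_pd_christoffel (hg : IsMetricOn g U) (hU : IsOpen U) (hx : x ∈ U) (l i j k : ι) :
    ∑ m, g x l m * pd i (christoffel g m j k) x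
      = pd i (christoffelLower g l j k) x
        - ∑ m, christoffelLower g m i l x * christoffel g m j k x
        - ∑ m, christoffelLower g l i m x * christoffel g m j k x := by
  have h : pd i (christoffelLower g l j k) x
      = pd i (fun y => ∑ m, g y l m * christoffel g m j k y) x :=
    (pd_congr i hU hx fun y hy => hg.sum_mul_christoffel hy l j k).symm
  rw [pd_sum_mul _ _ (fun m => differentiableAt_of_contDiffOn hU (hg.1 l m) hx)
    (fun m => differentiableAt_of_contDiffOn hU (hg.contDiffOn_christoffel hU m j k) hx)] at h
  simp only [hg.pd_eq_christoffelLower hU hx, add_mul, Finset.sum_add_distrib] at h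
  linarith

/-- The curvature tensor with all indices lowered. -/
theorem sum_mul_riemann (hg : IsMetricOn g U) (hU : IsOpen U) (hx : x ∈ U) (l k i j : ι) :
    ∑ m, g x l m * riemann g m k i j x
      = pd i (christoffelLower g l j k) x - pd j (christoffelLower g l i k) x
        - ∑ m, christoffelLower g m i l x * christoffel g m j k x
        + ∑ m, christoffelLower g m j l x * christoffel g m i k x := by
  have h : ∀ i j, ∑ m, g x l m * ∑ p, christoffel g m i p x * christoffel g p j k x
      = ∑ p, christoffelLower g l i p x * christoffel g p j k x := by
    intro i j
    simp only [Finset.mul_sum]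
    rw [Finset.sum_comm]
    simp only [← mul_assoc, ← Finset.sum_mul, hg.sum_mul_christoffel hx]
  simp only [riemann, Finset.sum_sub_distrib, mul_add, mul_sub, Finset.sum_add_distrib, h,
    hg.sum_mul_pd_christoffel hU hx]
  ring

/-- Metric compatibility: symmetrizing in l and k turns the derivative terms into ∂ᵢ∂ⱼ gₗₖ - ∂ⱼ∂ᵢ
gₗₖ = 0, and the quadratic terms cancel in pairs. -/
theorem sum_mul_riemann_antisymm (hg : IsMetricOn g U) (hU : IsOpen U) (hx : x ∈ U)
    (l k i j : ι) :
    ∑ m, g x l m * riemann g m k i j x = -∑ m, g x k m * riemann g m l i j x := by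
  have h : ∀ i j, pd i (christoffelLower g l j k) x + pd i (christoffelLower g k j l) x
      = pd i (pd j fun y => g y l k) x := by
    intro i j
    rw [pd_congr i hU hx fun y hy => hg.pd_eq_christoffelLower hU hy j l k,
      pd_add i (differentiableAt_of_contDiffOn hU (hg.contDiffOn_christoffelLower hU k j l) hx)
        (differentiableAt_of_contDiffOn hU (hg.contDiffOn_christoffelLower hU l j k) hx), add_comm]
  have h1 := h i j
  have h2 := h j i
  rw [pd_comm hU (hg.1 l k) hx j i] at h2
  have h3 := hg.sum_christoffelLower_mul_comm hx i j k l
  have h4 := hg.sum_christoffelLower_mul_comm hx j i k l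
  rw [hg.sum_mul_riemann hU hx, hg.sum_mul_riemann hU hx]
  linarith

end IsMetricOn

theorem riemann_antisymm (g : (ι → ℝ) → Matrix ι ι ℝ) (x : ι → ℝ) (l k i j : ι) :
    riemann g l k i j x = -riemann g l k j i x := by
  simp only [riemann, Finset.sum_sub_distrib]; ring

/-- In dimension three, a curvature-like tensor in an orthonormal frame vanishes if its
contraction does. -/
theorem eq_zero_of_contraction_fin_three {R : Fin 3 → Fin 3 → Fin 3 → Fin 3 → ℝ}
    (h1 : ∀ a b c d, R a b c d = -R b a c d) (h2 : ∀ a b c d, R a b c d = -R a b d c)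
    (h : ∀ b d, ∑ a, R a b a d = 0) (a b c d : Fin 3) : R a b c d = 0 := by
  have z1 : ∀ a c d, R a a c d = 0 := fun a c d => by linarith [h1 a a c d]
  have z2 : ∀ a b c, R a b c c = 0 := fun a b c => by linarith [h2 a b c c]
  have sw : ∀ a b c d, R a b c d = R b a d c := fun a b c d => by rw [h1, h2, neg_neg]
  simp only [Fin.sum_univ_three] at h
  -- Nine equations for nine unknowns, without using pair symmetry. Each off-diagonal contraction is
  -- a single component up to sign; the diagonal ones are the pairwise sums of the three sectional
  -- components, which therefore all vanish. The `s` and `t` identities reorder indices for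
  -- `linarith`.
  have key : ∀ a b c d, a < b → c < d → R a b c d = 0 := by
    have h00 := h 0 0
    have h01 := h 0 1
    have h02 := h 0 2
    have h10 := h 1 0
    have h11 := h 1 1
    have h12 := h 1 2
    have h20 := h 2 0
    have h21 := h 2 1
    have h22 := h 2 2
    simp only [z1, z2, zero_add, add_zero] at h00 h01 h02 h10 h11 h12 h20 h21 h22
    have s1 := sw 1 0 1 0
    have s2 := sw 2 0 2 0
    have s3 := sw 2 1 2 1
    have t1 := sw 2 0 2 1
    have t2 := sw 2 1 2 0
    have t3 := h2 1 0 1 2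
    have t4 := h1 1 0 2 1
    have t5 := h1 1 2 1 0
    have t6 := h2 2 1 1 0
    have t7 := h1 1 0 1 2
    have t8 := h2 1 2 1 0
    intro a b c d hab hcd
    fin_cases a <;> fin_cases b <;> simp at hab <;> fin_cases c <;> fin_cases d <;>
      simp at hcd <;> simp only [Fin.zero_eta, Fin.mk_one, Fin.reduceFinMk] <;> linarith
  rcases lt_trichotomy a b with hab | rfl | hab
  · rcases lt_trichotomy c d with hcd | rfl | hcd
    · exact key a b c d hab hcd
    · exact z2 a b c
    · rw [h2, key a b d c hab hcd, neg_zero]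
  · exact z1 a c d
  · rw [h1]
    rcases lt_trichotomy c d with hcd | rfl | hcd
    · rw [key b a c d hab hcd, neg_zero]
    · rw [z2, neg_zero]
    · rw [h2, key b a d c hab hcd, neg_zero, neg_zero]

theorem eq_zero_of_sum_mul_eq_zero {C : Matrix ι ι ℝ} (hC : IsUnit C.det) {v : ι → ℝ}
    (h : ∀ a, ∑ l, C a l * v l = 0) (l : ι) : v l = 0 := by
  have : C.mulVec v = 0 := funext h
  exact congrFun (Matrix.eq_zero_of_mulVec_eq_zero hC.ne_zero this) l

/-- Writing h = CᵀC and applying C to all four indices turns contraction with h into the orthonormal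
one; since C is invertible, the vanishing then transfers back one index at a time. -/
theorem eq_zero_of_contraction {h : Matrix (Fin 3) (Fin 3) ℝ} (hh : h.PosDef)
    {R : Fin 3 → Fin 3 → Fin 3 → Fin 3 → ℝ}
    (h1 : ∀ l k i j, R l k i j = -R k l i j) (h2 : ∀ l k i j, R l k i j = -R l k j i)
    (hR : ∀ k j, ∑ i, ∑ l, h i l * R l k i j = 0) (l k i j : Fin 3) : R l k i j = 0 := by
  obtain ⟨C, hC, hCh⟩ := exists_eq_transpose_mul_self hh
  have hz : ∀ a b c d, ∑ l, C a l * ∑ k, C b k * ∑ i, C c i * ∑ j, C d j * R l k i j = 0 := by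
    apply eq_zero_of_contraction_fin_three
    · intro a b c d
      simp only [Finset.mul_sum, ← Finset.sum_neg_distrib]
      rw [Finset.sum_comm]
      refine Finset.sum_congr rfl fun k _ => Finset.sum_congr rfl fun l _ =>
        Finset.sum_congr rfl fun i _ => Finset.sum_congr rfl fun j _ => ?_
      rw [h1]; ring
    · intro a b c d
      simp only [Finset.mul_sum, ← Finset.sum_neg_distrib]
      refine Finset.sum_congr rfl fun l _ => Finset.sum_congr rfl fun k _ => ?_
      rw [Finset.sum_comm]
      refine Finset.sum_congr rfl fun i _ => Finset.sum_congr rfl fun j _ => ?_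
      rw [h2]; ring
    · intro b d
      have : ∀ k j, ∑ a, ∑ l, ∑ i, C a l * (C b k * (C a i * (C d j * R l k i j)))
          = C b k * (C d j * ∑ i, ∑ l, h i l * R l k i j) := by
        intro k j
        simp only [hCh, Matrix.mul_apply, Matrix.transpose_apply, Finset.mul_sum, Finset.sum_mul]
        rw [Finset.sum_comm]
        conv_lhs => enter [2, l]; rw [Finset.sum_comm]
        rw [Finset.sum_comm]
        refine Finset.sum_congr rfl fun _ _ => Finset.sum_congr rfl fun _ _ =>
          Finset.sum_congr rfl fun _ _ => by ring
      calc _ = ∑ k, ∑ j, ∑ a, ∑ l, ∑ i, C a l * (C b k * (C a i * (C d j * R l k i j))) := by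
            simp only [Fin.sum_univ_three]; ring
        _ = 0 := by simp [this, hR]
  have hz1 := fun b c d => eq_zero_of_sum_mul_eq_zero hC fun a => hz a b c d
  have hz2 := fun l c d => eq_zero_of_sum_mul_eq_zero hC fun b => hz1 b c d l
  have hz3 := fun l k d => eq_zero_of_sum_mul_eq_zero hC fun c => hz2 l c d k
  exact eq_zero_of_sum_mul_eq_zero hC (fun d => hz3 l k d i) j

/-- A Ricci-flat metric in dimension three is flat. -/
theorem IsMetricOn.riemann_eq_zero {g : (Fin 3 → ℝ) → Matrix (Fin 3) (Fin 3) ℝ}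
    {U : Set (Fin 3 → ℝ)} (hg : IsMetricOn g U) (hU : IsOpen U) {x : Fin 3 → ℝ} (hx : x ∈ U)
    (hric : ∀ i j, ricci g i j x = 0) (l k i j : Fin 3) : riemann g l k i j x = 0 := by
  have hlow : ∀ l k i j, ∑ m, g x l m * riemann g m k i j x = 0 := by
    refine eq_zero_of_contraction (hg.2 x hx).inv (hg.sum_mul_riemann_antisymm hU hx) ?_ ?_
    · intro l k i j
      rw [← Finset.sum_neg_distrib]
      exact Finset.sum_congr rfl fun m _ => by rw [riemann_antisymm]; ring
    · intro k j
      rw [← hric j k, ricci]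
      refine Finset.sum_congr rfl fun i _ => ?_
      simp only [Finset.mul_sum]
      rw [Finset.sum_comm]
      simp only [← mul_assoc, ← Finset.sum_mul, hg.sum_inv_mul hx]
      simp
  exact eq_zero_of_sum_mul_eq_zero (isUnit_iff_ne_zero.2 (hg.det_ne_zero hx))
    (fun l => hlow l k i j) l

end Coord

/-! ### The Einstein equation on the orbifold -/

namespace OrbifoldAtlas.InvariantMetric

variable {n : ℕ} {B : Type*} [TopologicalSpace B] {O : OrbifoldAtlas n B} (X : O.InvariantMetric)

theorem isBundleData (a : O.ι) :
    Coord.IsBundleData (X.G ∘ O.q a) (X.A a) (X.base.g a) (O.U a) where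
  isOpen := O.isOpen_U a
  metric := X.base.isMetric a
  pos _ _ := X.G_pos _
  smooth := X.G_smooth a
  smooth_form := X.A_smooth a

theorem totalMetric_eq_bundleMetric (a : O.ι) :
    X.totalMetric a = Coord.bundleMetric (X.G ∘ O.q a) (X.A a) (X.base.g a) := rfl

/-- The fiber component of the Einstein equation. -/
theorem IsEinstein.laplacian_eq {X : O.InvariantMetric} {lam : ℝ} (h : X.IsEinstein lam) (a : O.ι)
    {x : Fin n → ℝ} (hx : x ∈ O.U a) :
    (1 / 2) * Coord.laplacian (X.base.g a) (X.G ∘ O.q a) x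
      = (1 / 4) * (∑ k, Coord.pd k (X.G ∘ O.q a) x * Coord.grad (X.base.g a) (X.G ∘ O.q a) k x)
          / X.G (O.q a x)
        + (1 / 4) * X.G (O.q a x) ^ 2 * Coord.curlNormSq (X.A a) (X.base.g a) x
        - lam * X.G (O.q a x) := by
  have h1 := h a (Sum.elim 0 x) hx (Sum.inl ()) (Sum.inl ())
  rw [totalMetric_eq_bundleMetric, (X.isBundleData a).ricci_inl_inl (p := Sum.elim 0 x) hx,
    Coord.bundleMetric_inl_inl] at h1
  simp only [Sum.elim_comp_inr, Function.comp_apply] at h1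
  linarith

end OrbifoldAtlas.InvariantMetric

theorem proposition3p4 {n : ℕ} {B : Type*} [TopologicalSpace B] [T2Space B] [ConnectedSpace B]
    (O : OrbifoldAtlas n B) (X : O.InvariantMetric) (lam : ℝ)
    (hEinstein : X.IsEinstein lam)
    (hparabolic : X.base.IsParabolic)
    (hlam : lam ≤ 0)
    (hG : ∃ C : ℝ, ∀ b, X.G b ≤ C) :
    (∃ c : ℝ, ∀ b, X.G b = c) ∧
    (∀ a, ∀ x ∈ O.U a, ∀ i j, X.F a i j x = 0) ∧
    lam = 0 ∧
    X.base.IsRicciFlat ∧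
    (n = 3 → X.base.IsFlat) := by
  have hnorm : ∀ a, ∀ x ∈ O.U a, 0 ≤ Coord.curlNormSq (X.A a) (X.base.g a) x := fun a x hx =>
    Coord.curlNormSq_nonneg (X.base.isMetric a) hx
  have hconst : ∃ c : ℝ, ∀ b, X.G b = c := by
    -- Subharmonicity is the fiber equation: `h1`, `h2`, `h3` are the signs of its gradient,
    -- curvature and λ terms.
    refine hparabolic X.G (fun b => (X.G_pos b).le) hG
      (fun a => (X.G_smooth a).of_le (WithTop.coe_le_coe.2 le_top)) fun a x hx => ?_
    have hpos := X.G_pos (O.q a x)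
    have h1 := div_nonneg (mul_nonneg (by norm_num : (0 : ℝ) ≤ 1 / 4)
      (Coord.sum_grad_mul_pd_nonneg (X.base.isMetric a) hx (X.G ∘ O.q a))) hpos.le
    have h2 := mul_nonneg (mul_nonneg (by norm_num : (0 : ℝ) ≤ 1 / 4) (sq_nonneg (X.G (O.q a x))))
      (hnorm a x hx)
    have h3 := mul_nonneg (neg_nonneg.2 hlam) hpos.le
    have := hEinstein.laplacian_eq a hx
    linarith
  obtain ⟨c, hc⟩ := hconst
  -- This holds on all of ℝⁿ, since `O.q a` is a total function, so the derivatives vanish without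
  -- restricting to the chart domain.
  have hGc : ∀ a, X.G ∘ O.q a = fun _ => c := fun a => funext fun x => hc _
  have hpd : ∀ a i x, Coord.pd i (X.G ∘ O.q a) x = 0 := fun a i x => by
    rw [hGc, Coord.pd_const]
  have hlap : ∀ a x, Coord.laplacian (X.base.g a) (X.G ∘ O.q a) x = 0 := fun a x => by
    have : ∀ j, Coord.pd j (X.G ∘ O.q a) = fun _ => 0 := fun j => funext (hpd a j)
    simp [Coord.laplacian, this, Coord.pd_const]
  have hboth : ∀ a, ∀ x ∈ O.U a, Coord.curlNormSq (X.A a) (X.base.g a) x = 0 ∧ lam = 0 := by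
    intro a x hx
    have hpos := X.G_pos (O.q a x)
    have h1 := hEinstein.laplacian_eq a hx
    -- What remains is 0 = ¼ G² |F|² - λG, a sum of two nonnegative terms.
    simp only [hlap, hpd, zero_mul, Finset.sum_const_zero, mul_zero, zero_div, zero_add] at h1
    have h2 := mul_nonneg (sq_nonneg (X.G (O.q a x))) (hnorm a x hx)
    have h3 := mul_nonneg (neg_nonneg.2 hlam) hpos.le
    have h4 : X.G (O.q a x) ^ 2 * Coord.curlNormSq (X.A a) (X.base.g a) x = 0 := by linarith
    have h5 : lam * X.G (O.q a x) = 0 := by linarith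
    exact ⟨(mul_eq_zero.1 h4).resolve_left (pow_pos hpos 2).ne',
      (mul_eq_zero.1 h5).resolve_right hpos.ne'⟩
  have hF : ∀ a, ∀ x ∈ O.U a, ∀ i j, Coord.curl (X.A a) i j x = 0 := fun a x hx i j =>
    Coord.curl_eq_zero_of_curlNormSq (X.base.isMetric a) hx (hboth a x hx).1 i j
  have hlam0 : lam = 0 := by
    obtain ⟨b⟩ := (inferInstance : Nonempty B)
    obtain ⟨a, x, hx, -⟩ := O.cover b
    exact (hboth a x hx).2
  have hric : X.base.IsRicciFlat := by
    intro a x hx i j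
    have h1 := hEinstein a (Sum.elim 0 x) hx (Sum.inr i) (Sum.inr j)
    rw [X.totalMetric_eq_bundleMetric, (X.isBundleData a).ricci_inr_inr (p := Sum.elim 0 x)
      (fun y _ i => hpd a i y) (hF a) hx, hlam0, zero_mul] at h1
    exact h1
  refine ⟨⟨c, hc⟩, hF, hlam0, hric, fun hn => ?_⟩
  subst hn
  intro a x hx
  exact (X.base.isMetric a).riemann_eq_zero (O.isOpen_U a) hx (hric a x hx)
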